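/- \textbf{Theorem (Noncommutative Chern--Weil homomorphism).} Let $k$ be a field, $C$ a $k$-coalgebra with a group-like element $e$, and $A$ a unital $k$-algebra with a right $C$-coaction $a\mapsto a_{(0)}\otimes a_{(1)}$ such that $1\mapsto 1\otimes e$. Let $B=\{b\in A \mid (ba)_{(0)}\otimes (ba)_{(1)}=ba_{(0)}\otimes a_{(1)}\ \text{for all } a\in A\}$. Assume that $B\subseteq A$ is a $C$-Galois extension, i.e. that the canonical map $\mathrm{can}\colon A\otimes_B A\to A\otimes C$, $a\otimes_B a'\mapsto aa'_{(0)}\otimes a'_{(1)}$, and the canonical entwining $\psi\colon C\otimes A\to A\otimes C$, $\psi(c\otimes a)=\mathrm{can}(\mathrm{can}^{-1}(1\otimes c)\,a)$, are both bijective; then $B=\{b\in A\mid b_{(0)}\otimes b_{(1)}=b\otimes e\}$. Let $A$ carry the left $C$-coaction $a\mapsto a_{(-1)}\otimes a_{(0)}:=\psi^{-1}(a\otimes e)$. Let $\ell\colon C\to A\otimes A$, $\ell(c)=c^{\langle 1\rangle}\otimes c^{\langle 2\rangle}$ (summation understood), be a strong connection: a $k$-linear map that is left $C$-colinear for the left coaction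 on the left factor, right $C$-colinear for the right coaction on the right factor, and lifts the translation map $\tau\colon C\to A\otimes_B A$, $\tau(c)=\mathrm{can}^{-1}(1\otimes c)$ (unitality $\ell(e)=1\otimes 1$ is not required). Let $M=A\,\Box^C A=\{\sum_i a_i\otimes a_i'\in A\otimes A\mid \sum_i a_{i(0)}\otimes a_{i(1)}\otimes a_i'=\sum_i a_i\otimes a'_{i(-1)}\otimes a'_{i(0)}\}$, let $\varepsilon\colon M\to B$, $\sum_i a_i\otimes a'_i\mapsto\sum_i a_ia'_i$, and make $M$ a (possibly non-unital) $k$-algebra by $m\cdot m'=\varepsilon(m)m'$, so that $\varepsilon$ is an algebra map. Let $C^{\mathrm{tr}}=\{c\in C\mid c_{(1)}\otimes c_{(2)}=c_{(2)}\otimes c_{(1)}\}$ be the space of cotraces. For a $k$-algebra $R$ let $\mathrm{Tot\,CC}_n(R)=\bigoplus_{m=0}^{n}R^{\otimes (m+1)}$ be the total complex of the cyclic bicomplex (with $R^{\otimes(m+1)}$ in row $m$; vertical differentials $b$ in the even columns and $-b'$ in the odd ones; horizontal differentials $1-t$ out of the odd columns and $N$ out of the even columns $\geq 2$; $t(a_0\otimes\cdots\otimes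 a_m)=(-1)^m a_m\otimes a_0\otimes\cdots\otimes a_{m-1}$), let $\mathrm{HC}_n(R)$ be its homology, and let $S\colon \mathrm{HC}_{n+2}(R)\to \mathrm{HC}_n(R)$ be Connes' periodicity operator, induced by dropping the columns $0$ and $1$. Then for every $m\geq 0$ there is a linear map $\mathrm{c}_m(\ell)\colon C^{\mathrm{tr}}\to M^{\otimes (m+1)}$, necessarily unique, such that in $(A\otimes A)^{\otimes (m+1)}$ $$\mathrm{c}_m(\ell)(c)=\bigl(c_{(m+1)}{}^{\langle 2\rangle}\otimes c_{(1)}{}^{\langle 1\rangle}\bigr)\otimes\bigl(c_{(1)}{}^{\langle 2\rangle}\otimes c_{(2)}{}^{\langle 1\rangle}\bigr)\otimes\cdots\otimes\bigl(c_{(m)}{}^{\langle 2\rangle}\otimes c_{(m+1)}{}^{\langle 1\rangle}\bigr).$$ For all $n\geq 0$ and $c\in C^{\mathrm{tr}}$ the chain $$\widetilde{\mathrm{chw}}_n(\ell,c)=\sum_{m=0}^{2n}(-1)^{\lfloor m/2\rfloor}\frac{m!}{\lfloor m/2\rfloor!}\,\mathrm{c}_m(\ell)(c)$$ is a $2n$-cycle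 in $\mathrm{Tot\,CC}_\bullet(M)$, and its homology class is stable under $S$: $S[\widetilde{\mathrm{chw}}_{n+1}(\ell,c)]=[\widetilde{\mathrm{chw}}_n(\ell,c)]$ in $\mathrm{HC}_{2n}(M)$. Composing with the map induced by $\varepsilon$ gives a linear map, the Chern--Weil map $\mathrm{chw}_n(\ell)\colon C^{\mathrm{tr}}\to \mathrm{HC}_{2n}(B)$, $c\mapsto \mathrm{HC}_{2n}(\varepsilon)[\widetilde{\mathrm{chw}}_n(\ell,c)]$. -/

import Mathlib

open scoped TensorProduct

set_option linter.unusedSectionVars false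

noncomputable section

namespace ChernWeil

/-! ## Cyclic homology of a possibly non-unital algebra over a field

`⨂[k]^(m + 1) R` is the `(m + 1)`-st tensor power of `R` over `k`, sitting in simplicial degree `m`;
its pure tensors are `a₀ ⊗ ⋯ ⊗ aₘ`. -/

section Cyclic

lemma contractNth_update {R : Type*} [Mul R] {n : ℕ} (j : Fin (n + 1)) (a : Fin (n + 2) → R)
    (i : Fin (n + 2)) (x : R) :
    Fin.contractNth j.castSucc (· * ·) (Function.update a i x) =
      Function.update (Fin.contractNth j.castSucc (· * ·) a) (j.predAbove i)
        (if i = j.castSucc then x * a j.succ else if i = j.succ then a j.castSucc * x else x) := by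
  have hp : ((j.predAbove i : Fin (n + 1)) : ℕ) = if (j : ℕ) < i then (i : ℕ) - 1 else i := by
    by_cases h : j.castSucc < i
    · have h' : (j : ℕ) < i := h
      rw [Fin.predAbove_of_castSucc_lt _ _ h, if_pos h', Fin.val_pred]
    · have h' : ¬ (j : ℕ) < i := h
      rw [Fin.predAbove_of_le_castSucc _ _ (not_lt.1 h), if_neg h', Fin.coe_castPred]
  have := j.2
  funext l
  simp only [Fin.contractNth, Function.update_apply, Fin.ext_iff, hp, Fin.val_castSucc,
    Fin.val_succ]
  split_ifs <;> first | rfl | omega | (congr 2; simp only [Fin.ext_iff, Fin.val_castSucc, Fin.val_succ]; omega)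

variable (k : Type*) [Field k]
variable (R : Type*) [NonUnitalRing R] [Module k R] [IsScalarTower k R R] [SMulCommClass k R R]

/-- The face operator `dⱼ`, for `0 ≤ j ≤ n`, on simplicial degree `n + 1`:
`a₀ ⊗ ⋯ ⊗ aₙ₊₁ ↦ a₀ ⊗ ⋯ ⊗ aⱼ aⱼ₊₁ ⊗ ⋯ ⊗ aₙ₊₁`. -/
def face (n : ℕ) (j : Fin (n + 1)) : ⨂[k]^(n + 2) R →ₗ[k] ⨂[k]^(n + 1) R :=
  PiTensorProduct.lift
    { toFun := fun a => PiTensorProduct.tprod k (Fin.contractNth j.castSucc (· * ·) a)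
      map_update_add' := by
        intro inst a i x y
        rw [Subsingleton.elim inst (instDecidableEqFin _)]
        simp only [contractNth_update]
        rw [← MultilinearMap.map_update_add]
        congr 2
        split_ifs <;> simp [add_mul, mul_add]
      map_update_smul' := by
        intro inst a i r x
        rw [Subsingleton.elim inst (instDecidableEqFin _)]
        simp only [contractNth_update]
        rw [← MultilinearMap.map_update_smul]
        congr 2
        split_ifs <;> simp [smul_mul_assoc, mul_smul_comm] }

lemma face_tprod (n : ℕ) (j : Fin (n + 1)) (a : Fin (n + 2) → R) :
    face k R n j (PiTensorProduct.tprod k a) =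
      PiTensorProduct.tprod k (Fin.contractNth j.castSucc (· * ·) a) :=
  PiTensorProduct.lift.tprod a

/-- The cyclic rotation without sign, `a₀ ⊗ ⋯ ⊗ aₙ ↦ aₙ ⊗ a₀ ⊗ ⋯ ⊗ aₙ₋₁`. -/
def rotate (n : ℕ) : ⨂[k]^(n + 1) R →ₗ[k] ⨂[k]^(n + 1) R :=
  (PiTensorProduct.reindex k (fun _ => R) (finRotate (n + 1))).toLinearMap

/-- The last face operator `a₀ ⊗ ⋯ ⊗ aₙ₊₁ ↦ aₙ₊₁ a₀ ⊗ a₁ ⊗ ⋯ ⊗ aₙ`. -/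
def lastFace (n : ℕ) : ⨂[k]^(n + 2) R →ₗ[k] ⨂[k]^(n + 1) R :=
  face k R n 0 ∘ₗ rotate k R (n + 1)

/-- The cyclic operator `t`, with its sign:
`a₀ ⊗ ⋯ ⊗ aₙ ↦ (-1)ⁿ aₙ ⊗ a₀ ⊗ ⋯ ⊗ aₙ₋₁`. -/
def cyclicOp (n : ℕ) : ⨂[k]^(n + 1) R →ₗ[k] ⨂[k]^(n + 1) R :=
  (-1 : k) ^ n • rotate k R n

/-- The norm operator `N = 1 + t + ⋯ + tⁿ`. -/
def norm (n : ℕ) : ⨂[k]^(n + 1) R →ₗ[k] ⨂[k]^(n + 1) R :=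
  ∑ i ∈ Finset.range (n + 1), cyclicOp k R n ^ i

/-- The bar differential `b' = ∑_{j ≤ n} (-1)ʲ dⱼ` on simplicial degree `n + 1`. -/
def bar (n : ℕ) : ⨂[k]^(n + 2) R →ₗ[k] ⨂[k]^(n + 1) R :=
  ∑ j : Fin (n + 1), (-1 : k) ^ (j : ℕ) • face k R n j

/-- The Hochschild differential `b = b' + (-1)ⁿ⁺¹ dₙ₊₁` on simplicial degree `n + 1`. -/
def hochschild (n : ℕ) : ⨂[k]^(n + 2) R →ₗ[k] ⨂[k]^(n + 1) R :=
  bar k R n + (-1 : k) ^ (n + 1) • lastFace k R n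

/-- The vertical differential of the cyclic bicomplex in column `p`, from row `q + 1` to row `q`:
`b` in the even columns and `-b'` in the odd ones. -/
def vertical (p q : ℕ) : ⨂[k]^(q + 2) R →ₗ[k] ⨂[k]^(q + 1) R :=
  if Even p then hochschild k R q else -bar k R q

/-- The horizontal differential of the cyclic bicomplex in row `q`, from column `p ≥ 1` to column
`p - 1`: it is `1 - t` if `p` is odd and `N` if `p` is even. -/
def horizontal (p q : ℕ) : ⨂[k]^(q + 1) R →ₗ[k] ⨂[k]^(q + 1) R :=
  if Even p then norm k R q else LinearMap.id - cyclicOp k R q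

/-- Degree `n` of the total complex `Tot CC(R)` of the cyclic bicomplex. The component with
index `q` has row `q` and column `n - q`. -/
abbrev Tot (n : ℕ) : Type _ := (q : Fin (n + 1)) → ⨂[k]^((q : ℕ) + 1) R

/-- The differential of the total complex of the cyclic bicomplex. -/
def totD (n : ℕ) : Tot k R (n + 1) →ₗ[k] Tot k R n :=
  LinearMap.pi fun q : Fin (n + 1) =>
    vertical k R (n - q) q ∘ₗ LinearMap.proj (φ := fun i : Fin (n + 2) => ⨂[k]^((i : ℕ) + 1) R) q.succ
    + horizontal k R (n + 1 - q) q ∘ₗ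
        LinearMap.proj (φ := fun i : Fin (n + 2) => ⨂[k]^((i : ℕ) + 1) R) q.castSucc

/-- The `n`-cycles of `Tot CC(R)`. -/
def cycles : (n : ℕ) → Submodule k (Tot k R n)
  | 0 => ⊤
  | n + 1 => LinearMap.ker (totD k R n)

/-- The `n`-boundaries of `Tot CC(R)`. -/
def boundaries (n : ℕ) : Submodule k (Tot k R n) := LinearMap.range (totD k R n)

/-- Cyclic homology `HCₙ(R)`: the homology of `Tot CC(R)` in degree `n`. -/
abbrev HC (n : ℕ) : Type _ := cycles k R n ⧸ (boundaries k R n).submoduleOf (cycles k R n)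

variable {k R}

/-- The class in cyclic homology of a cycle of `Tot CC(R)`. -/
def HC.mk {n : ℕ} {x : Tot k R n} (hx : x ∈ cycles k R n) : HC k R n :=
  Submodule.Quotient.mk ⟨x, hx⟩

/-- The map on homology induced by a degree-shifting map that respects cycles and boundaries. -/
def homologyMap {R' : Type*} [NonUnitalRing R'] [Module k R'] [IsScalarTower k R' R']
    [SMulCommClass k R' R'] {m n : ℕ} (f : Tot k R m →ₗ[k] Tot k R' n)
    (hc : ∀ x ∈ cycles k R m, f x ∈ cycles k R' n)
    (hb : ∀ x ∈ boundaries k R m, f x ∈ boundaries k R' n) : HC k R m →ₗ[k] HC k R' n :=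
  Submodule.mapQ _ _ (f.restrict hc) fun x hx => hb x.1 hx

variable (k R)

/-- Connes' periodicity operator on the total complex: it forgets the two columns `0` and `1`. -/
def periodicity (n : ℕ) : Tot k R (n + 2) →ₗ[k] Tot k R n :=
  LinearMap.pi fun q : Fin (n + 1) =>
    LinearMap.proj (φ := fun i : Fin (n + 3) => ⨂[k]^((i : ℕ) + 1) R)
      (q.castLE (Nat.le_add_right (n + 1) 2))

lemma totD_periodicity (n : ℕ) (x : Tot k R (n + 3)) :
    totD k R n (periodicity k R (n + 1) x) = periodicity k R n (totD k R (n + 2) x) := by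
  funext q
  have hq : n + 2 - (q : ℕ) = n - q + 2 := by omega
  have hq' : n + 2 + 1 - (q : ℕ) = n + 1 - q + 2 := by omega
  have e1 : vertical k R (n + 2 - q) q = vertical k R (n - q) q := by
    simp only [vertical, hq, Nat.even_add, even_two, iff_true]
  have e2 : horizontal k R (n + 2 + 1 - q) q = horizontal k R (n + 1 - q) q := by
    simp only [horizontal, hq', Nat.even_add, even_two, iff_true]
  change vertical k R (n - q) q _ + horizontal k R (n + 1 - q) q _ =
    vertical k R (n + 2 - q) q _ + horizontal k R (n + 2 + 1 - q) q _
  rw [e1, e2]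
  rfl

/-- Connes' periodicity operator `S : HCₙ₊₂(R) → HCₙ(R)`. -/
def HC.S (n : ℕ) : HC k R (n + 2) →ₗ[k] HC k R n :=
  homologyMap (periodicity k R n)
    (by
      intro x hx
      cases n with
      | zero => exact Submodule.mem_top
      | succ n =>
        have hx' : totD k R (n + 2) x = 0 := hx
        change totD k R n _ = 0
        rw [totD_periodicity, hx', map_zero])
    (by
      rintro _ ⟨y, rfl⟩
      exact ⟨periodicity k R (n + 1) y, totD_periodicity k R n y⟩)

variable {k R}
variable {R' : Type*} [NonUnitalRing R'] [Module k R'] [IsScalarTower k R' R']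
  [SMulCommClass k R' R']

lemma map_face (f : R →ₙₐ[k] R') (n : ℕ) (j : Fin (n + 1)) (x : ⨂[k]^(n + 2) R) :
    face k R' n j (PiTensorProduct.map (fun _ => (f : R →ₗ[k] R')) x) =
      PiTensorProduct.map (fun _ => (f : R →ₗ[k] R')) (face k R n j x) := by
  refine LinearMap.congr_fun (f := face k R' n j ∘ₗ PiTensorProduct.map _)
    (g := PiTensorProduct.map _ ∘ₗ face k R n j) (PiTensorProduct.ext ?_) x
  ext a
  simp only [LinearMap.compMultilinearMap_apply, LinearMap.comp_apply, PiTensorProduct.map_tprod,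
    face_tprod]
  congr 1
  funext l
  simp only [Fin.contractNth]
  split_ifs <;> simp

lemma map_rotate (f : R →ₙₐ[k] R') (n : ℕ) (x : ⨂[k]^(n + 1) R) :
    rotate k R' n (PiTensorProduct.map (fun _ => (f : R →ₗ[k] R')) x) =
      PiTensorProduct.map (fun _ => (f : R →ₗ[k] R')) (rotate k R n x) :=
  (PiTensorProduct.map_reindex (fun _ => (f : R →ₗ[k] R')) (finRotate (n + 1)) x).symm

lemma map_cyclicOp (f : R →ₙₐ[k] R') (n : ℕ) (x : ⨂[k]^(n + 1) R) :
    cyclicOp k R' n (PiTensorProduct.map (fun _ => (f : R →ₗ[k] R')) x) =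
      PiTensorProduct.map (fun _ => (f : R →ₗ[k] R')) (cyclicOp k R n x) := by
  simp only [cyclicOp, LinearMap.smul_apply, map_rotate, map_smul]

lemma map_norm (f : R →ₙₐ[k] R') (n : ℕ) (x : ⨂[k]^(n + 1) R) :
    norm k R' n (PiTensorProduct.map (fun _ => (f : R →ₗ[k] R')) x) =
      PiTensorProduct.map (fun _ => (f : R →ₗ[k] R')) (norm k R n x) := by
  have key (i : ℕ) : (cyclicOp k R' n ^ i) (PiTensorProduct.map (fun _ => (f : R →ₗ[k] R')) x) =
      PiTensorProduct.map (fun _ => (f : R →ₗ[k] R')) ((cyclicOp k R n ^ i) x) := by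
    induction i with
    | zero => simp
    | succ i ih => rw [pow_succ', pow_succ', Module.End.mul_apply, ih, map_cyclicOp,
        Module.End.mul_apply]
  simp only [norm, LinearMap.sum_apply, key, map_sum]

lemma map_bar (f : R →ₙₐ[k] R') (n : ℕ) (x : ⨂[k]^(n + 2) R) :
    bar k R' n (PiTensorProduct.map (fun _ => (f : R →ₗ[k] R')) x) =
      PiTensorProduct.map (fun _ => (f : R →ₗ[k] R')) (bar k R n x) := by
  simp only [bar, LinearMap.sum_apply, LinearMap.smul_apply, map_face, map_sum, map_smul]

lemma map_hochschild (f : R →ₙₐ[k] R') (n : ℕ) (x : ⨂[k]^(n + 2) R) :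
    hochschild k R' n (PiTensorProduct.map (fun _ => (f : R →ₗ[k] R')) x) =
      PiTensorProduct.map (fun _ => (f : R →ₗ[k] R')) (hochschild k R n x) := by
  simp only [hochschild, lastFace, LinearMap.add_apply, LinearMap.smul_apply, LinearMap.comp_apply,
    map_bar, map_rotate, map_face, map_add, map_smul]

lemma map_vertical (f : R →ₙₐ[k] R') (p q : ℕ) (x : ⨂[k]^(q + 2) R) :
    vertical k R' p q (PiTensorProduct.map (fun _ => (f : R →ₗ[k] R')) x) =
      PiTensorProduct.map (fun _ => (f : R →ₗ[k] R')) (vertical k R p q x) := by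
  simp only [vertical]
  split_ifs
  · exact map_hochschild f q x
  · simp only [LinearMap.neg_apply, map_bar, map_neg]

lemma map_horizontal (f : R →ₙₐ[k] R') (p q : ℕ) (x : ⨂[k]^(q + 1) R) :
    horizontal k R' p q (PiTensorProduct.map (fun _ => (f : R →ₗ[k] R')) x) =
      PiTensorProduct.map (fun _ => (f : R →ₗ[k] R')) (horizontal k R p q x) := by
  simp only [horizontal]
  split_ifs
  · exact map_norm f q x
  · simp only [LinearMap.sub_apply, LinearMap.id_apply, map_cyclicOp, map_sub]

/-- The map `R^{⊗ (n + 1)} → R'^{⊗ (n + 1)}` induced by an algebra map, componentwise on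
`Tot CC`. -/
def totMap (f : R →ₙₐ[k] R') (n : ℕ) : Tot k R n →ₗ[k] Tot k R' n :=
  LinearMap.pi fun q : Fin (n + 1) =>
    PiTensorProduct.map (fun _ => (f : R →ₗ[k] R')) ∘ₗ
      LinearMap.proj (φ := fun i : Fin (n + 1) => ⨂[k]^((i : ℕ) + 1) R) q

lemma totD_totMap (f : R →ₙₐ[k] R') (n : ℕ) (x : Tot k R (n + 1)) :
    totD k R' n (totMap f (n + 1) x) = totMap f n (totD k R n x) := by
  funext q
  change vertical k R' (n - q) q (PiTensorProduct.map _ _) +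
    horizontal k R' (n + 1 - q) q (PiTensorProduct.map _ _) =
    PiTensorProduct.map _ (vertical k R (n - q) q _ + horizontal k R (n + 1 - q) q _)
  rw [map_add]
  exact congrArg₂ (· + ·) (map_vertical f (n - q) q (x q.succ))
    (map_horizontal f (n + 1 - q) q (x q.castSucc))

/-- The map `HCₙ(R) → HCₙ(R')` induced by an algebra map. -/
def HC.map (f : R →ₙₐ[k] R') (n : ℕ) : HC k R n →ₗ[k] HC k R' n :=
  homologyMap (totMap f n)
    (by
      intro x hx
      cases n with
      | zero => exact Submodule.mem_top
      | succ n =>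
        have hx' : totD k R n x = 0 := hx
        change totD k R' n _ = 0
        rw [totD_totMap, hx', map_zero])
    (by
      rintro _ ⟨y, rfl⟩
      exact ⟨totMap f (n + 1) y, totD_totMap f n y⟩)

end Cyclic

/-! ## Coalgebra-Galois extensions -/

section Galois

variable {k : Type*} [Field k]
variable {C : Type*} [AddCommGroup C] [Module k C] [Coalgebra k C]
variable {A : Type*} [Ring A] [Algebra k A]

variable (k C) in
/-- The space of cotraces: the elements `c` with `c₍₁₎ ⊗ c₍₂₎ = c₍₂₎ ⊗ c₍₁₎`. -/
def cotraces : Submodule k C :=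
  LinearMap.eqLocus (Coalgebra.comul (R := k) (A := C))
    ((TensorProduct.comm k C C).toLinearMap ∘ₗ Coalgebra.comul)

/-- The coaction invariants `B = {b | ρ (b a) = b ρ (a) for all a}`. For a `C`-Galois extension
with `ρ(1) = 1 ⊗ e` they are exactly the `b` with `ρ(b) = b ⊗ e`: see
`GaloisExtension.mem_B_iff`. -/
def coinvariants (ρ : A →ₗ[k] A ⊗[k] C) : Subalgebra k A where
  carrier := {b | ∀ a, ρ (b * a) = b • ρ a}
  mul_mem' := by
    intro b b' hb hb' a
    rw [mul_assoc, hb, hb', mul_smul]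
  add_mem' := by
    intro b b' hb hb' a
    rw [add_mul, map_add, hb, hb', add_smul]
  algebraMap_mem' := by
    intro r a
    rw [← Algebra.smul_def, map_smul, algebraMap_smul]

/-- The subspace of `A ⊗ A` spanned by all `x b ⊗ y - x ⊗ b y` with `b ∈ B`. -/
def balancing (B : Subalgebra k A) : Submodule k (A ⊗[k] A) :=
  Submodule.span k {z | ∃ x y : A, ∃ b ∈ B, z = (x * b) ⊗ₜ[k] y - x ⊗ₜ[k] (b * y)}

/-- The tensor product `A ⊗_B A` over the (noncommutative) subalgebra `B`. -/
abbrev BalancedTensor (B : Subalgebra k A) : Type _ := (A ⊗[k] A) ⧸ balancing B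

/-- The right action of `A` on `A ⊗_B A`, `(x ⊗_B y) ⊗ a ↦ x ⊗_B y a`. -/
def rightAct (B : Subalgebra k A) : BalancedTensor B ⊗[k] A →ₗ[k] BalancedTensor B :=
  TensorProduct.lift <| (balancing B).liftQ
    (TensorProduct.curry ((balancing B).mkQ ∘ₗ (LinearMap.mul' k A).lTensor A ∘ₗ
      (TensorProduct.assoc k A A A).toLinearMap))
    (Submodule.span_le.2 <| by
      rintro _ ⟨x, y, b, hb, rfl⟩
      ext a
      have : (x * b) ⊗ₜ[k] (y * a) - x ⊗ₜ[k] (b * y * a) ∈ balancing B := by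
        rw [mul_assoc]
        exact Submodule.subset_span ⟨x, y * a, b, hb, rfl⟩
      simpa [sub_eq_zero] using (Submodule.Quotient.eq _).2 this)

lemma rightAct_mk_tmul (B : Subalgebra k A) (x y a : A) :
    rightAct B ((balancing B).mkQ (x ⊗ₜ y) ⊗ₜ a) = (balancing B).mkQ (x ⊗ₜ (y * a)) := rfl

lemma mul'_smul (a : A) (x : A ⊗[k] A) :
    LinearMap.mul' k A (a • x) = a * LinearMap.mul' k A x := by
  induction x with
  | zero => simp
  | tmul x y => simp [TensorProduct.smul_tmul', mul_assoc]
  | add x y hx hy => simp only [smul_add, map_add, hx, hy, mul_add]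

/-- The map `A ⊗ A → A ⊗ C`, `x ⊗ y ↦ x y₍₀₎ ⊗ y₍₁₎`. -/
def canLift (ρ : A →ₗ[k] A ⊗[k] C) : A ⊗[k] A →ₗ[k] A ⊗[k] C :=
  (LinearMap.mul' k A).rTensor C ∘ₗ (TensorProduct.assoc k A A C).symm.toLinearMap ∘ₗ ρ.lTensor A

lemma canLift_tmul (ρ : A →ₗ[k] A ⊗[k] C) (x y : A) : canLift ρ (x ⊗ₜ y) = x • ρ y := by
  simp only [canLift, LinearMap.comp_apply, LinearMap.lTensor_tmul]
  induction ρ y with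
  | zero => simp
  | tmul a c => simp [TensorProduct.smul_tmul']
  | add z w hz hw => simp only [TensorProduct.tmul_add, map_add, hz, hw, smul_add]

lemma canLift_smul (ρ : A →ₗ[k] A ⊗[k] C) (a : A) (t : A ⊗[k] A) :
    canLift ρ (a • t) = a • canLift ρ t := by
  induction t with
  | zero => simp
  | tmul x y => simp only [TensorProduct.smul_tmul', canLift_tmul, smul_eq_mul, mul_smul]
  | add z w hz hw => simp only [map_add, hz, hw, smul_add]

/-- The canonical map `A ⊗_B A → A ⊗ C`, `x ⊗_B y ↦ x y₍₀₎ ⊗ y₍₁₎`. -/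
def can (ρ : A →ₗ[k] A ⊗[k] C) : BalancedTensor (coinvariants ρ) →ₗ[k] A ⊗[k] C :=
  (balancing (coinvariants ρ)).liftQ (canLift ρ) (Submodule.span_le.2 <| by
    rintro _ ⟨x, y, b, hb, rfl⟩
    simp [canLift_tmul, hb y, mul_smul])

/-- The translation map `τ(c) = can⁻¹(1 ⊗ c)`. -/
def translation (ρ : A →ₗ[k] A ⊗[k] C) (h : Function.Bijective (can ρ)) :
    C →ₗ[k] BalancedTensor (coinvariants ρ) :=
  (LinearEquiv.ofBijective (can ρ) h).symm.toLinearMap ∘ₗ TensorProduct.mk k A C 1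

/-- The canonical entwining `ψ : C ⊗ A → A ⊗ C`, `ψ(c ⊗ a) = can(can⁻¹(1 ⊗ c) a)`. -/
def entwining (ρ : A →ₗ[k] A ⊗[k] C) (h : Function.Bijective (can ρ)) :
    C ⊗[k] A →ₗ[k] A ⊗[k] C :=
  can ρ ∘ₗ rightAct (coinvariants ρ) ∘ₗ (translation ρ h).rTensor A

lemma can_mk (ρ : A →ₗ[k] A ⊗[k] C) (t : A ⊗[k] A) :
    can ρ ((balancing (coinvariants ρ)).mkQ t) = canLift ρ t := rfl

lemma can_translation (ρ : A →ₗ[k] A ⊗[k] C) (h : Function.Bijective (can ρ)) (c : C) :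
    can ρ (translation ρ h c) = 1 ⊗ₜ c :=
  (LinearEquiv.ofBijective (can ρ) h).apply_symm_apply _

/-- Left `A`-linearity of `z ⊗ a ↦ can (can⁻¹(z) a)`, in terms of representatives. -/
lemma can_rightAct_smul (ρ : A →ₗ[k] A ⊗[k] C) (a y : A) (t : A ⊗[k] A) :
    can ρ (rightAct _ ((balancing (coinvariants ρ)).mkQ (a • t) ⊗ₜ y)) =
      a • can ρ (rightAct _ ((balancing (coinvariants ρ)).mkQ t ⊗ₜ y)) := by
  induction t with
  | zero => simp
  | tmul x z =>
    simp only [TensorProduct.smul_tmul', smul_eq_mul, rightAct_mk_tmul, can_mk, canLift_tmul,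
      mul_smul]
  | add z w hz hw => simp only [map_add, TensorProduct.add_tmul, hz, hw, smul_add]

/-- `(a ⊗ c) ⊗ y ↦ a ψ(c ⊗ y)`. -/
def entwiningLift (ρ : A →ₗ[k] A ⊗[k] C) (h : Function.Bijective (can ρ)) :
    A ⊗[k] (C ⊗[k] A) →ₗ[k] A ⊗[k] C :=
  (LinearMap.mul' k A).rTensor C ∘ₗ (TensorProduct.assoc k A A C).symm.toLinearMap ∘ₗ
    (entwining ρ h).lTensor A

lemma entwiningLift_tmul (ρ : A →ₗ[k] A ⊗[k] C) (h : Function.Bijective (can ρ)) (a : A)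
    (z : C ⊗[k] A) : entwiningLift ρ h (a ⊗ₜ z) = a • entwining ρ h z := by
  simp only [entwiningLift, LinearMap.comp_apply, LinearMap.lTensor_tmul]
  induction entwining ρ h z with
  | zero => simp
  | tmul a c => simp [TensorProduct.smul_tmul']
  | add z w hz hw => simp only [TensorProduct.tmul_add, map_add, hz, hw, smul_add]

lemma can_rightAct (ρ : A →ₗ[k] A ⊗[k] C) (h : Function.Bijective (can ρ))
    (q : BalancedTensor (coinvariants ρ)) (y : A) :
    can ρ (rightAct _ (q ⊗ₜ y)) =
      entwiningLift ρ h (TensorProduct.assoc k A C A (can ρ q ⊗ₜ y)) := by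
  obtain ⟨z, rfl⟩ := (LinearEquiv.ofBijective (can ρ) h).symm.surjective q
  have hz : can ρ ((LinearEquiv.ofBijective (can ρ) h).symm z) = z :=
    (LinearEquiv.ofBijective (can ρ) h).apply_symm_apply z
  rw [hz]
  clear hz
  induction z with
  | zero => simp
  | tmul a c =>
    rw [TensorProduct.assoc_tmul, entwiningLift_tmul]
    obtain ⟨t, ht⟩ := (balancing (coinvariants ρ)).mkQ_surjective (translation ρ h c)
    have hc : (LinearEquiv.ofBijective (can ρ) h).symm (a ⊗ₜ c) =
        (balancing (coinvariants ρ)).mkQ (a • t) := by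
      rw [LinearEquiv.symm_apply_eq]
      change _ = can ρ _
      rw [can_mk, canLift_smul, ← can_mk, ht, can_translation, TensorProduct.smul_tmul',
        smul_eq_mul, mul_one]
    rw [hc, can_rightAct_smul, ht]
    rfl
  | add z w hz hw => simp only [map_add, TensorProduct.add_tmul, hz, hw]

lemma coact_mul (ρ : A →ₗ[k] A ⊗[k] C) (h : Function.Bijective (can ρ)) (x y : A) :
    ρ (x * y) = entwiningLift ρ h (TensorProduct.assoc k A C A (ρ x ⊗ₜ y)) := by
  have h1 := can_rightAct ρ h ((balancing (coinvariants ρ)).mkQ (1 ⊗ₜ x)) y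
  simpa only [rightAct_mk_tmul, can_mk, canLift_tmul, one_smul] using h1

variable (k C A) in
/-- A `C`-Galois extension `B ⊆ A`: an algebra `A` with a right `C`-coaction `ρ`, a group-like
element `e ∈ C` with `ρ(1) = 1 ⊗ e`, such that the canonical map and the canonical entwining are
both invertible. -/
structure GaloisExtension where
  /-- The right coaction `a ↦ a₍₀₎ ⊗ a₍₁₎`. -/
  coact : A →ₗ[k] A ⊗[k] C
  coact_coassoc : (TensorProduct.assoc k A C C).toLinearMap ∘ₗ coact.rTensor C ∘ₗ coact =
    (Coalgebra.comul (R := k) (A := C)).lTensor A ∘ₗ coact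
  coact_counit : (TensorProduct.rid k A).toLinearMap ∘ₗ
    (Coalgebra.counit (R := k) (A := C)).lTensor A ∘ₗ coact = LinearMap.id
  /-- The distinguished group-like element. -/
  e : C
  isGroupLike_e : IsGroupLikeElem k e
  coact_one : coact 1 = 1 ⊗ₜ e
  can_bijective : Function.Bijective (can coact)
  entwining_bijective : Function.Bijective (entwining coact can_bijective)

namespace GaloisExtension

variable (G : GaloisExtension k C A)

/-- The base algebra `B` of coaction invariants. -/
abbrev B : Subalgebra k A := coinvariants G.coact

/-- The left coaction `a ↦ a₍₋₁₎ ⊗ a₍₀₎ := ψ⁻¹(a ⊗ e)` on `A`. -/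
def leftCoact : A →ₗ[k] C ⊗[k] A :=
  (LinearEquiv.ofBijective _ G.entwining_bijective).symm.toLinearMap ∘ₗ
    (TensorProduct.mk k A C).flip G.e

/-- A strong connection: a `C`-bicolinear map `ℓ : C → A ⊗ A`, where `C` coacts from the left on
the left factor and from the right on the right factor of `A ⊗ A`, that lifts the translation map.
Unitality `ℓ(e) = 1 ⊗ 1` is not required. -/
structure IsStrongConnection (ℓ : C →ₗ[k] A ⊗[k] A) : Prop where
  left_colinear : (TensorProduct.assoc k C A A).toLinearMap ∘ₗ G.leftCoact.rTensor A ∘ₗ ℓ =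
    ℓ.lTensor C ∘ₗ Coalgebra.comul
  right_colinear : G.coact.lTensor A ∘ₗ ℓ =
    (TensorProduct.assoc k A A C).toLinearMap ∘ₗ ℓ.rTensor C ∘ₗ Coalgebra.comul
  lifts : (balancing G.B).mkQ ∘ₗ ℓ = translation G.coact G.can_bijective

/-- For a Galois extension the base algebra is `{b | ρ(b) = b ⊗ e}`. -/
theorem mem_B_iff (b : A) : b ∈ G.B ↔ G.coact b = b ⊗ₜ G.e := by
  constructor
  · intro hb
    have := hb 1
    rwa [mul_one, G.coact_one, TensorProduct.smul_tmul', smul_eq_mul, mul_one] at this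
  · intro hb a
    have hq : (balancing G.B).mkQ (b ⊗ₜ 1) = (balancing G.B).mkQ (1 ⊗ₜ b) := by
      apply G.can_bijective.1
      rw [can_mk, can_mk, canLift_tmul, canLift_tmul, one_smul, hb, G.coact_one,
        TensorProduct.smul_tmul', smul_eq_mul, mul_one]
    have := congrArg (fun q => can G.coact (rightAct G.B (q ⊗ₜ a))) hq
    simpa only [rightAct_mk_tmul, can_mk, canLift_tmul, one_mul, one_smul] using this.symm

/-- The cotensor product `M = A □^C A`: the equalizer in `A ⊗ A` of the maps
`x ⊗ y ↦ x₍₀₎ ⊗ x₍₁₎ ⊗ y` and `x ⊗ y ↦ x ⊗ y₍₋₁₎ ⊗ y₍₀₎`. -/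
def cotensor : Submodule k (A ⊗[k] A) :=
  LinearMap.eqLocus ((TensorProduct.assoc k A C A).toLinearMap ∘ₗ G.coact.rTensor A)
    (G.leftCoact.lTensor A)

lemma mul_mem_B {x : A ⊗[k] A} (hx : x ∈ G.cotensor) : LinearMap.mul' k A x ∈ G.B := by
  rw [mem_B_iff]
  have h1 (z : A ⊗[k] A) : G.coact (LinearMap.mul' k A z) =
      entwiningLift G.coact G.can_bijective
        (TensorProduct.assoc k A C A (G.coact.rTensor A z)) := by
    induction z with
    | zero => simp
    | tmul x y => simpa using coact_mul G.coact G.can_bijective x y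
    | add z w hz hw => simp only [map_add, hz, hw]
  have h2 (z : A ⊗[k] A) : entwiningLift G.coact G.can_bijective (G.leftCoact.lTensor A z) =
      LinearMap.mul' k A z ⊗ₜ G.e := by
    induction z with
    | zero => simp
    | tmul x y =>
      have : entwining G.coact G.can_bijective (G.leftCoact y) = y ⊗ₜ G.e :=
        (LinearEquiv.ofBijective _ G.entwining_bijective).apply_symm_apply _
      rw [LinearMap.lTensor_tmul, entwiningLift_tmul, this, TensorProduct.smul_tmul',
        LinearMap.mul'_apply, smul_eq_mul]
    | add z w hz hw => simp only [map_add, hz, hw, TensorProduct.add_tmul]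
  have hx' : TensorProduct.assoc k A C A (G.coact.rTensor A x) = G.leftCoact.lTensor A x := hx
  rw [h1, hx', h2]

lemma smul_mem_cotensor {b : A} (hb : b ∈ G.B) {x : A ⊗[k] A} (hx : x ∈ G.cotensor) :
    b • x ∈ G.cotensor := by
  have h1 (z : A ⊗[k] A) : G.coact.rTensor A (b • z) = b • G.coact.rTensor A z := by
    induction z with
    | zero => simp
    | tmul x y => simp only [TensorProduct.smul_tmul', LinearMap.rTensor_tmul, smul_eq_mul, hb x]
    | add z w hz hw => simp only [map_add, hz, hw, smul_add]
  have h2 (z : A ⊗[k] A) : G.leftCoact.lTensor A (b • z) = b • G.leftCoact.lTensor A z := by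
    induction z with
    | zero => simp
    | tmul x y => simp only [TensorProduct.smul_tmul', LinearMap.lTensor_tmul]
    | add z w hz hw => simp only [map_add, hz, hw, smul_add]
  have h3 (z : (A ⊗[k] C) ⊗[k] A) : TensorProduct.assoc k A C A (b • z) =
      b • TensorProduct.assoc k A C A z := by
    induction z with
    | zero => simp
    | tmul w y =>
      induction w with
      | zero => simp
      | tmul x c => simp only [TensorProduct.smul_tmul', TensorProduct.assoc_tmul]
      | add z w hz hw => simp only [TensorProduct.add_tmul, map_add, hz, hw, smul_add]
    | add z w hz hw => simp only [map_add, hz, hw, smul_add]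
  have hx' : TensorProduct.assoc k A C A (G.coact.rTensor A x) = G.leftCoact.lTensor A x := hx
  change TensorProduct.assoc k A C A (G.coact.rTensor A (b • x)) = G.leftCoact.lTensor A (b • x)
  rw [h1, h3, hx', h2]

/-- The row-extension algebra: the vector space `M = A □^C A` with the multiplication
`m m' = ε(m) m'`, where `ε(∑ a ⊗ a') = ∑ a a'`. -/
def M : Type _ := G.cotensor

instance : AddCommGroup G.M := inferInstanceAs (AddCommGroup G.cotensor)

instance : Module k G.M := inferInstanceAs (Module k G.cotensor)

/-- The inclusion `M → A ⊗ A`. -/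
def incl : G.M →ₗ[k] A ⊗[k] A := G.cotensor.subtype

lemma incl_injective : Function.Injective G.incl := Subtype.val_injective

instance : Mul G.M :=
  ⟨fun m m' => ⟨LinearMap.mul' k A (G.incl m) • G.incl m',
    G.smul_mem_cotensor (G.mul_mem_B m.2) m'.2⟩⟩

lemma incl_mul (m m' : G.M) :
    G.incl (m * m') = LinearMap.mul' k A (G.incl m) • G.incl m' := rfl

instance : NonUnitalRing G.M where
  __ := (inferInstance : AddCommGroup G.M)
  mul := (· * ·)
  left_distrib a b c := G.incl_injective (by simp [incl_mul])
  right_distrib a b c := G.incl_injective (by simp [incl_mul, add_smul])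
  zero_mul a := G.incl_injective (by simp [incl_mul])
  mul_zero a := G.incl_injective (by simp [incl_mul])
  mul_assoc a b c := G.incl_injective (by
    simp [incl_mul, mul'_smul, mul_smul])

instance : IsScalarTower k G.M G.M :=
  ⟨fun r a b => G.incl_injective (by
    change LinearMap.mul' k A (r • G.incl a) • G.incl b = r • G.incl (a * b)
    rw [incl_mul, map_smul, smul_assoc])⟩

instance : SMulCommClass k G.M G.M :=
  ⟨fun r a b => G.incl_injective (by
    change r • incl G (a * b) = LinearMap.mul' k A (G.incl a) • (r • G.incl b)
    rw [incl_mul, smul_comm])⟩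

/-- The augmentation `ε : M → B`, `∑ a ⊗ a' ↦ ∑ a a'`, which is an algebra map. -/
def augmentation : G.M →ₙₐ[k] G.B where
  toFun m := ⟨LinearMap.mul' k A (G.incl m), G.mul_mem_B m.2⟩
  map_smul' r m := Subtype.ext (by simp)
  map_zero' := Subtype.ext (by simp)
  map_add' m m' := Subtype.ext (by simp)
  map_mul' m m' := Subtype.ext (by simp [incl_mul, mul'_smul])

/-- The inclusion `M^{⊗ (m + 1)} → (A ⊗ A)^{⊗ (m + 1)}`. -/
def inclPow (m : ℕ) : ⨂[k]^(m + 1) G.M →ₗ[k] ⨂[k]^(m + 1) (A ⊗[k] A) :=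
  PiTensorProduct.map fun _ => G.incl

theorem inclPow_injective (m : ℕ) : Function.Injective (G.inclPow m) := by
  obtain ⟨p, hp⟩ := G.incl.exists_leftInverse_of_injective (LinearMap.ker_eq_bot.2 G.incl_injective)
  refine Function.LeftInverse.injective (g := PiTensorProduct.map fun _ => p) fun x => ?_
  rw [inclPow, ← LinearMap.comp_apply, ← PiTensorProduct.map_comp, hp, PiTensorProduct.map_id,
    LinearMap.id_apply]

end GaloisExtension

/-- For `ℓ(c) = c^⟨1⟩ ⊗ c^⟨2⟩`, the map
`c ↦ (c₍₁₎^⟨1⟩ ⊗ ⋯ ⊗ c₍ₘ₊₁₎^⟨1⟩) ⊗ (c₍₁₎^⟨2⟩ ⊗ ⋯ ⊗ c₍ₘ₊₁₎^⟨2⟩)`. -/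
def legs (ℓ : C →ₗ[k] A ⊗[k] A) : (m : ℕ) → C →ₗ[k] (⨂[k]^(m + 1) A) ⊗[k] (⨂[k]^(m + 1) A)
  | 0 =>
    TensorProduct.map
      (PiTensorProduct.subsingletonEquiv (R := k) (s := fun _ : Fin 1 => A) 0).symm.toLinearMap
      (PiTensorProduct.subsingletonEquiv (R := k) (s := fun _ : Fin 1 => A) 0).symm.toLinearMap ∘ₗ ℓ
  | m + 1 =>
    TensorProduct.map TensorPower.mulEquiv.toLinearMap TensorPower.mulEquiv.toLinearMap ∘ₗ
      (TensorProduct.tensorTensorTensorComm k (⨂[k]^(m + 1) A) (⨂[k]^(m + 1) A)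
        (⨂[k]^1 A) (⨂[k]^1 A)).toLinearMap ∘ₗ
      TensorProduct.map (legs ℓ m) (legs ℓ 0) ∘ₗ Coalgebra.comul

/-- The map `C → (A ⊗ A)^{⊗ (m + 1)}`,
`c ↦ (c₍ₘ₊₁₎^⟨2⟩ ⊗ c₍₁₎^⟨1⟩) ⊗ (c₍₁₎^⟨2⟩ ⊗ c₍₂₎^⟨1⟩) ⊗ ⋯ ⊗ (c₍ₘ₎^⟨2⟩ ⊗ c₍ₘ₊₁₎^⟨1⟩)`. -/
def circular (ℓ : C →ₗ[k] A ⊗[k] A) (m : ℕ) : C →ₗ[k] ⨂[k]^(m + 1) (A ⊗[k] A) :=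
  TensorProduct.lift (PiTensorProduct.map₂ fun _ => (TensorProduct.mk k A A).flip) ∘ₗ
    (rotate k A m).lTensor _ ∘ₗ legs ℓ m

end Galois

/-- The chain `∑_{m ≤ 2n} (-1)^⌊m/2⌋ (m! / ⌊m/2⌋!) xₘ` of degree `2n` in `Tot CC(R)`. The quotient
of factorials is an integer, so the natural-number division is exact. -/
def chernChain {k : Type*} [Field k] {R : Type*} [NonUnitalRing R] [Module k R]
    (x : (m : ℕ) → ⨂[k]^(m + 1) R) (n : ℕ) : Tot k R (2 * n) :=
  fun m => ((-1 : k) ^ ((m : ℕ) / 2) * ((Nat.factorial m / Nat.factorial (m / 2) : ℕ) : k)) • x m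

end ChernWeil

end

open scoped TensorProduct

set_option linter.unusedSectionVars false

noncomputable section

namespace ChernWeil

/-! ### Cyclic sequences and the cycle condition -/

section Cyclic

variable {k : Type*} [Field k]

/-! The cycle property is formal. Call (x_m) a cyclic sequence if each x_m is invariant under the
unsigned rotation and the last face of x_{m+1} is x_m. The relation d_{j+1} ∘ rotate = rotate ∘ d_j
then forces every face of x_{m+1} to be x_m. Hence b', b, 1 - t and N act on the x_m by scalars: b'
x_{m+1} is x_m for even m and 0 for odd m, b x_{m+1} is 0 for even m and x_m for odd m, t x_m =
(-1)^m x_m, and N x_m is (m+1) x_m or 0. In the total complex, ∑ γ_m x_m is a cycle exactly when the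
coefficients cancel in each row, and γ_{2r+1} = (2r+1) γ_{2r}, γ_{2r+2} = -2 γ_{2r+1} suffice; the
stated factorials solve this recursion (`IsCyclicSequence.chernChain_mem_cycles`). The γ_m do not
depend on n, so periodicity, which only discards the two top terms, preserves the chains on the
nose.

It remains to produce the cyclic sequence in M. The product of M makes sense on all of A ⊗ A
(`PairAlg`), and M^{⊗(m+1)} embeds in (A ⊗ A)^{⊗(m+1)} compatibly with faces and rotation, so both
identities may be checked there. Rotation invariance is the cotrace condition: `legsPow` can be
built by appending a leg on either side, and the rotation exchanges the two constructions
(`rotatePair_legsPow`). The last face creates c_{(m+2)}^⟨1⟩ c_{(m+2)}^⟨2⟩, which is a counit because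
ℓ lifts the translation map (`IsStrongConnection.mul'_apply`).

That the tensor lies in M^{⊗(m+1)} is again a matter of one slot. In slot 0, c_{(m+1)}^⟨2⟩ ⊗
c_{(1)}^⟨1⟩, right colinearity inserts an extra last Sweedler leg and left colinearity an extra
first one; for a cotrace these agree. So a projection of A ⊗ A onto M fixes the tensor in slot 0, by
rotation in every slot, and hence in all slots at once (`map_eq_of_mapZero_eq`,
`IsStrongConnection.exists_inclPow_eq`). -/

lemma rotate_tprod {V : Type*} [NonUnitalRing V] [Module k V] [IsScalarTower k V V]
    [SMulCommClass k V V] (n : ℕ) (a : Fin (n + 1) → V) :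
    rotate k V n (PiTensorProduct.tprod k a) =
      PiTensorProduct.tprod k (fun i => a ((finRotate (n + 1)).symm i)) :=
  PiTensorProduct.reindex_tprod _ _

lemma snoc_comp_finRotate_symm {V : Type*} {n : ℕ} (a : Fin n → V) (b : V) :
    (fun i => (Fin.snoc a b : Fin (n + 1) → V) ((finRotate (n + 1)).symm i)) =
      (Fin.cons b a : Fin (n + 1) → V) := by
  funext i
  obtain ⟨j, rfl⟩ := (finRotate (n + 1)).surjective i
  rw [Equiv.symm_apply_apply]
  refine Fin.lastCases ?_ (fun j => ?_) j
  · simp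
  · rw [Fin.snoc_castSucc, finRotate_apply, Fin.coeSucc_eq_succ, Fin.cons_succ]

variable {R : Type*} [NonUnitalRing R] [Module k R] [IsScalarTower k R R] [SMulCommClass k R R]

/-- Rotating first shifts the multiplied pair one place to the right. Since `j < n`, the pair avoids
the last entry, the one that wraps around. -/
lemma face_succ_rotate (n : ℕ) (j : Fin n) (x : ⨂[k]^(n + 2) R) :
    face k R n j.succ (rotate k R (n + 1) x) = rotate k R n (face k R n j.castSucc x) := by
  refine LinearMap.congr_fun (f := face k R n j.succ ∘ₗ rotate k R (n + 1))
    (g := rotate k R n ∘ₗ face k R n j.castSucc) (PiTensorProduct.ext ?_) x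
  ext a
  induction a using Fin.snocCases with
  | _ v b
  simp only [LinearMap.compMultilinearMap_apply, LinearMap.comp_apply, rotate_tprod, face_tprod,
    snoc_comp_finRotate_symm]
  -- The contraction leaves the last entry `b` alone, so its result can again be written with
  -- `Fin.snoc` and rotated.
  have h : Fin.contractNth j.castSucc.castSucc (· * ·) (Fin.snoc v b : Fin (n + 2) → R) =
      (Fin.snoc (α := fun _ => R) (fun i : Fin n => Fin.contractNth j.castSucc.castSucc (· * ·)
        (Fin.snoc v b : Fin (n + 2) → R) i.castSucc) b : Fin (n + 1) → R) := by
    funext i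
    refine Fin.lastCases ?_ (fun i => ?_) i
    · rw [Fin.snoc_last, Fin.contractNth_apply_of_gt]
      · rw [Fin.succ_last, Fin.snoc_last]
      · simp
    · rw [Fin.snoc_castSucc]
  rw [h, snoc_comp_finRotate_symm]
  congr 1
  funext i
  refine Fin.cases ?_ (fun i => ?_) i
  · rw [Fin.cons_zero, Fin.contractNth_apply_of_lt]
    · rfl
    · simp
  · rw [Fin.cons_succ]
    have hs : ∀ l : Fin (n + 1), (Fin.snoc v b : Fin (n + 2) → R) l.castSucc = v l := fun l => by
      rw [Fin.snoc_castSucc]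
    rcases lt_trichotomy (i : ℕ) j with hij | hij | hij
    · rw [Fin.contractNth_apply_of_lt _ _ _ _ (by simpa using hij),
        Fin.contractNth_apply_of_lt _ _ _ _ (by simpa using hij), hs]
      rfl
    · rw [Fin.contractNth_apply_of_eq _ _ _ _ (by simpa using hij),
        Fin.contractNth_apply_of_eq _ _ _ _ (by simpa using hij), hs, ← Fin.castSucc_succ, hs]
      rfl
    · rw [Fin.contractNth_apply_of_gt _ _ _ _ (by simpa using hij),
        Fin.contractNth_apply_of_gt _ _ _ _ (by simpa using hij), ← Fin.castSucc_succ, hs]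
      rfl

/-- By definition the last face is d_0 after a rotation, so invariance of `x` gives d_0 x = y. Then
d_{j+1} x = d_{j+1} (rotate x) = rotate (d_j x) = rotate y = y. -/
lemma face_eq_of_rotate_eq {n : ℕ} {x : ⨂[k]^(n + 2) R} {y : ⨂[k]^(n + 1) R}
    (hx : rotate k R (n + 1) x = x) (hy : rotate k R n y = y) (h : lastFace k R n x = y)
    (j : Fin (n + 1)) : face k R n j x = y := by
  induction j using Fin.induction with
  | zero => rwa [lastFace, LinearMap.comp_apply, hx] at h
  | succ j ih => rw [← hx, face_succ_rotate, ih, hy]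

/-- This and the next lemma are the coefficient recursion up to sign. They are stated in ℕ, where
the division is exact, so that no characteristic of `k` has to be excluded. -/
lemma factorial_div_factorial_two_mul_add_one (r : ℕ) :
    (2 * r + 1).factorial / r.factorial = (2 * r + 1) * ((2 * r).factorial / r.factorial) := by
  rw [Nat.factorial_succ, Nat.mul_div_assoc _ (Nat.factorial_dvd_factorial (by omega))]

lemma factorial_div_factorial_two_mul_add_two (r : ℕ) :
    (2 * r + 2).factorial / (r + 1).factorial = 2 * ((2 * r + 1).factorial / r.factorial) := by
  obtain ⟨d, hd⟩ : r.factorial ∣ (2 * r + 1).factorial := Nat.factorial_dvd_factorial (by omega)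
  rw [hd, Nat.mul_div_cancel_left _ r.factorial_pos]
  refine Nat.div_eq_of_eq_mul_right (r + 1).factorial_pos ?_
  rw [Nat.factorial_succ (2 * r + 1), hd, Nat.factorial_succ r]
  ring

/-- A sequence of cyclically invariant tensors whose faces are all equal to the preceding term. -/
structure IsCyclicSequence (x : (m : ℕ) → ⨂[k]^(m + 1) R) : Prop where
  rotate_eq : ∀ m, rotate k R m (x m) = x m
  lastFace_eq : ∀ m, lastFace k R m (x (m + 1)) = x m

namespace IsCyclicSequence

variable {x : (m : ℕ) → ⨂[k]^(m + 1) R}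

lemma face_eq (hx : IsCyclicSequence x) (m : ℕ) (j : Fin (m + 1)) : face k R m j (x (m + 1)) = x m :=
  face_eq_of_rotate_eq (hx.rotate_eq _) (hx.rotate_eq _) (hx.lastFace_eq m) j

lemma bar_eq (hx : IsCyclicSequence x) (m : ℕ) : bar k R m (x (m + 1)) = (if Even m then (1 : k) else 0) • x m := by
  simp only [bar, LinearMap.sum_apply, LinearMap.smul_apply, hx.face_eq, ← Finset.sum_smul]
  rw [Fin.sum_univ_eq_sum_range (fun i => (-1 : k) ^ i), neg_one_geom_sum]
  rcases Nat.even_or_odd m with h | h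
  · simp [Nat.even_add_one, h]
  · simp [h, Nat.not_even_iff_odd.2 h]

/-- The last face contributes one more sign to the alternating sum, which exchanges the parities at
which it vanishes. -/
lemma hochschild_eq (hx : IsCyclicSequence x) (m : ℕ) :
    hochschild k R m (x (m + 1)) = (if Even m then (0 : k) else 1) • x m := by
  rw [hochschild, LinearMap.add_apply, LinearMap.smul_apply, hx.bar_eq, hx.lastFace_eq, ← add_smul]
  rcases Nat.even_or_odd m with h | h
  · simp [h, h.neg_one_pow, pow_succ]
  · simp [Nat.not_even_iff_odd.2 h, h.neg_one_pow, pow_succ]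

lemma cyclicOp_eq (hx : IsCyclicSequence x) (m : ℕ) : cyclicOp k R m (x m) = (-1 : k) ^ m • x m := by
  rw [cyclicOp, LinearMap.smul_apply, hx.rotate_eq]

lemma norm_eq (hx : IsCyclicSequence x) (m : ℕ) : norm k R m (x m) = (if Even m then (m + 1 : k) else 0) • x m := by
  have key (i : ℕ) : (cyclicOp k R m ^ i) (x m) = ((-1 : k) ^ m) ^ i • x m := by
    induction i with
    | zero => simp
    | succ i ih =>
      rw [pow_succ', Module.End.mul_apply, ih, map_smul, hx.cyclicOp_eq, smul_smul, ← pow_succ]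
  simp only [norm, LinearMap.sum_apply, key, ← Finset.sum_smul]
  rcases Nat.even_or_odd m with h | h
  · simp [h, h.neg_one_pow]
  · simp [h.neg_one_pow, neg_one_geom_sum, Nat.even_add_one, Nat.not_even_iff_odd.2 h]

theorem chernChain_mem_cycles (hx : IsCyclicSequence x) (n : ℕ) :
    chernChain x n ∈ cycles k R (2 * n) := by
  cases n with
  | zero => exact Submodule.mem_top
  | succ n =>
    change totD k R (2 * n + 1) (chernChain x (n + 1)) = 0
    funext q
    have hq : (q : ℕ) ≤ 2 * n + 1 := by omega
    change vertical k R (2 * n + 1 - q) q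
        (((-1 : k) ^ (((q : ℕ) + 1) / 2) *
          ((((q : ℕ) + 1).factorial / (((q : ℕ) + 1) / 2).factorial : ℕ) : k)) • x (q + 1)) +
      horizontal k R (2 * n + 1 + 1 - q) q
        (((-1 : k) ^ ((q : ℕ) / 2) *
          (((q : ℕ).factorial / ((q : ℕ) / 2).factorial : ℕ) : k)) • x q) = 0
    rw [map_smul, map_smul, vertical, horizontal]
    generalize (q : ℕ) = q at hq
    rcases Nat.even_or_odd q with h | h
    -- For even `q` the vertical map starts in an odd column and the horizontal one in an even
    -- column: -b' meets N, and the cancellation is γ_{q+1} = (q+1) γ_q.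
    · rw [if_neg (by grind), if_pos (by grind), LinearMap.neg_apply, hx.bar_eq, hx.norm_eq,
        if_pos h, if_pos h]
      obtain ⟨r, rfl⟩ := h.two_dvd
      rw [show (2 * r + 1) / 2 = r by omega, show 2 * r / 2 = r by omega,
        factorial_div_factorial_two_mul_add_one, smul_smul, ← smul_neg, one_smul, smul_neg,
        ← neg_smul, ← add_smul]
      convert zero_smul k _
      push_cast
      ring
    -- For odd `q`, b meets 1 - t, and 1 - t acts as 2, so the cancellation is γ_{q+1} = -2 γ_q.
    · rw [if_pos (by grind), if_neg (by grind), LinearMap.sub_apply, hx.hochschild_eq,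
        hx.cyclicOp_eq, if_neg (by grind), h.neg_one_pow, LinearMap.id_apply]
      obtain ⟨r, rfl⟩ := h
      rw [show (2 * r + 1 + 1) / 2 = r + 1 by omega, show (2 * r + 1) / 2 = r by omega,
        factorial_div_factorial_two_mul_add_two, one_smul, neg_smul, one_smul, sub_neg_eq_add,
        smul_add, ← add_smul, ← add_smul]
      convert zero_smul k _
      push_cast
      ring

end IsCyclicSequence
end Cyclic

/-! ### Operators acting on a single tensor slot -/

section Slots

variable {k : Type*} [Field k]
variable {V : Type*} [NonUnitalRing V] [Module k V] [IsScalarTower k V V] [SMulCommClass k V V]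

lemma rotate_map (n : ℕ) (f : Fin (n + 1) → V →ₗ[k] V) (x : ⨂[k]^(n + 1) V) :
    rotate k V n (PiTensorProduct.map f x) =
      PiTensorProduct.map (fun i => f ((finRotate (n + 1)).symm i)) (rotate k V n x) :=
  (PiTensorProduct.map_reindex f (finRotate (n + 1)) x).symm

/-- The map `a₀ ⊗ a₁ ⊗ ⋯ ⊗ aₙ ↦ f(a₀) ⊗ a₁ ⊗ ⋯ ⊗ aₙ`, linear in `f`. -/
def mapZero (n : ℕ) : (V →ₗ[k] V) →ₗ[k] (⨂[k]^(n + 1) V →ₗ[k] ⨂[k]^(n + 1) V) :=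
  (PiTensorProduct.mapMultilinear k (fun _ : Fin (n + 1) => V) (fun _ => V)).toLinearMap
    (fun _ => LinearMap.id) 0

lemma mapZero_eq (n : ℕ) (f : V →ₗ[k] V) :
    mapZero n f = PiTensorProduct.map (Function.update (fun _ => LinearMap.id) 0 f) := rfl

lemma mapZero_tprod (n : ℕ) (f : V →ₗ[k] V) (v : Fin (n + 1) → V) (w : V) :
    mapZero n f (PiTensorProduct.tprod k (Function.update v 0 w)) =
      PiTensorProduct.tprod k (Function.update v 0 (f w)) := by
  rw [mapZero_eq, PiTensorProduct.map_tprod]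
  congr 1
  funext i
  by_cases h : i = 0
  · subst h; simp
  · simp [h]

/-- A cyclically invariant tensor that is fixed by `f` in slot `0` is fixed by `f ⊗ ⋯ ⊗ f`. -/
lemma map_eq_of_mapZero_eq {n : ℕ} {x : ⨂[k]^(n + 1) V} (hx : rotate k V n x = x)
    (f : V →ₗ[k] V) (h : mapZero n f x = x) : PiTensorProduct.map (fun _ => f) x = x := by
  -- Conjugation by the rotation moves an operator from slot j to slot j + 1.
  have slot (j : Fin (n + 1)) :
      PiTensorProduct.map (Function.update (fun _ => LinearMap.id) j f) x = x := by
    induction j using Fin.induction with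
    | zero => exact h
    | succ j ih =>
      have := congrArg (rotate k V n) ih
      rw [rotate_map, hx] at this
      convert this using 3
      funext i
      obtain ⟨l, rfl⟩ := (finRotate (n + 1)).surjective i
      have hj : j.succ = finRotate (n + 1) j.castSucc := by
        rw [finRotate_apply, Fin.coeSucc_eq_succ]
      rw [Equiv.symm_apply_apply, hj]
      simp only [Function.update_apply, EmbeddingLike.apply_eq_iff_eq]
  -- The operator `f` is switched on one slot at a time; each step composes with a single-slot
  -- operator that fixes `x`.
  have key (s : Finset (Fin (n + 1))) :
      PiTensorProduct.map (s.piecewise (fun _ => f) fun _ => LinearMap.id) x = x := by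
    induction s using Finset.induction_on with
    | empty => simp [PiTensorProduct.map_id]
    | insert j s hj ih =>
      have hfun : ((insert j s).piecewise (fun _ => f) fun _ => LinearMap.id) =
          fun i => Function.update (fun _ => LinearMap.id) j f i ∘ₗ
            (s.piecewise (fun _ => f) fun _ => (LinearMap.id : V →ₗ[k] V)) i := by
        funext i
        by_cases hi : i = j
        · subst hi; simp [hj]
        · by_cases his : i ∈ s <;> simp [hi, his]
      rw [hfun, PiTensorProduct.map_comp, LinearMap.comp_apply, ih, slot]
  simpa using key Finset.univ

end Slots

/-! ### Iterated coproduct legs and their rotation -/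

section Legs

variable {k : Type*} [Field k]
variable {A : Type*} [Ring A] [Algebra k A]

variable (k A) in
/-- Pairs of tensors of length `n`. -/
abbrev PairPow (n : ℕ) : Type _ := (⨂[k]^n A) ⊗[k] (⨂[k]^n A)

lemma PairPow.hom_ext {n : ℕ} {E : Type*} [AddCommGroup E] [Module k E]
    {f g : PairPow k A n →ₗ[k] E}
    (h : ∀ a a' : Fin n → A, f (PiTensorProduct.tprod k a ⊗ₜ PiTensorProduct.tprod k a') =
      g (PiTensorProduct.tprod k a ⊗ₜ PiTensorProduct.tprod k a')) : f = g := by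
  refine TensorProduct.ext (PiTensorProduct.ext ?_)
  ext a : 1
  refine PiTensorProduct.ext ?_
  ext a'
  exact h a a'

lemma subsingletonEquiv_symm_eq_tprod (b : A) :
    (PiTensorProduct.subsingletonEquiv (R := k) (s := fun _ : Fin 1 => A) 0).symm b =
      PiTensorProduct.tprod k fun _ => b := by
  rw [LinearEquiv.symm_apply_eq, PiTensorProduct.subsingletonEquiv_apply_tprod]

variable (k A) in
/-- `(a₁ ⊗ ⋯ ⊗ aₙ) ⊗ a ↦ a₁ ⊗ ⋯ ⊗ aₙ ⊗ a`. -/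
def snocTensor (n : ℕ) : (⨂[k]^n A) ⊗[k] A →ₗ[k] ⨂[k]^(n + 1) A :=
  TensorPower.mulEquiv.toLinearMap ∘ₗ
    (PiTensorProduct.subsingletonEquiv (R := k) (s := fun _ : Fin 1 => A) 0).symm.toLinearMap.lTensor _

lemma snocTensor_tmul {n : ℕ} (a : Fin n → A) (b : A) :
    snocTensor k A n (PiTensorProduct.tprod k a ⊗ₜ b) =
      PiTensorProduct.tprod k (Fin.snoc a b : Fin (n + 1) → A) := by
  rw [← Fin.append_right_eq_snoc a (fun _ => b)]
  refine Eq.trans ?_ (TensorPower.tprod_mul_tprod k a (fun _ : Fin 1 => b))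
  rw [snocTensor, LinearMap.comp_apply, LinearMap.lTensor_tmul]
  exact congrArg (fun y => TensorPower.mulEquiv (PiTensorProduct.tprod k a ⊗ₜ[k] y))
    (subsingletonEquiv_symm_eq_tprod b)

variable (k A) in
/-- `a ⊗ (a₁ ⊗ ⋯ ⊗ aₙ) ↦ a ⊗ a₁ ⊗ ⋯ ⊗ aₙ`. -/
def consTensor (n : ℕ) : (⨂[k]^n A) ⊗[k] A →ₗ[k] ⨂[k]^(n + 1) A :=
  rotate k A n ∘ₗ snocTensor k A n

lemma consTensor_tmul {n : ℕ} (a : Fin n → A) (b : A) :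
    consTensor k A n (PiTensorProduct.tprod k a ⊗ₜ b) =
      PiTensorProduct.tprod k (Fin.cons b a : Fin (n + 1) → A) := by
  rw [consTensor, LinearMap.comp_apply, snocTensor_tmul, rotate_tprod, snoc_comp_finRotate_symm]

variable (k A) in
/-- Appends a pair on the right. -/
def snocPair (n : ℕ) : PairPow k A n ⊗[k] (A ⊗[k] A) →ₗ[k] PairPow k A (n + 1) :=
  TensorProduct.map (snocTensor k A n) (snocTensor k A n) ∘ₗ
    (TensorProduct.tensorTensorTensorComm k _ _ _ _).toLinearMap

variable (k A) in
/-- Appends a pair on the left. -/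
def consPair (n : ℕ) : (A ⊗[k] A) ⊗[k] PairPow k A n →ₗ[k] PairPow k A (n + 1) :=
  TensorProduct.map (consTensor k A n) (consTensor k A n) ∘ₗ
    (TensorProduct.tensorTensorTensorComm k _ _ _ _).toLinearMap ∘ₗ
    (TensorProduct.comm k _ _).toLinearMap

variable (k A) in
/-- The simultaneous rotation of both tensors. -/
def rotatePair (n : ℕ) : PairPow k A (n + 1) →ₗ[k] PairPow k A (n + 1) :=
  TensorProduct.map (rotate k A n) (rotate k A n)

lemma rotatePair_snocPair (n : ℕ) (x : PairPow k A n) (w : A ⊗[k] A) :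
    rotatePair k A n (snocPair k A n (x ⊗ₜ w)) = consPair k A n (w ⊗ₜ x) := by
  simp only [rotatePair, snocPair, consPair, consTensor, TensorProduct.map_comp,
    LinearMap.comp_apply, LinearEquiv.coe_coe, TensorProduct.comm_tmul]

lemma snocPair_tmul {n : ℕ} (a a' : Fin n → A) (b b' : A) :
    snocPair k A n ((PiTensorProduct.tprod k a ⊗ₜ PiTensorProduct.tprod k a') ⊗ₜ (b ⊗ₜ b')) =
      PiTensorProduct.tprod k (Fin.snoc a b : Fin (n + 1) → A) ⊗ₜ
        PiTensorProduct.tprod k (Fin.snoc a' b' : Fin (n + 1) → A) := by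
  simp only [snocPair, LinearMap.comp_apply, LinearEquiv.coe_coe,
    TensorProduct.tensorTensorTensorComm_tmul, TensorProduct.map_tmul, snocTensor_tmul]

lemma consPair_tmul {n : ℕ} (a a' : Fin n → A) (b b' : A) :
    consPair k A n ((b ⊗ₜ b') ⊗ₜ (PiTensorProduct.tprod k a ⊗ₜ PiTensorProduct.tprod k a')) =
      PiTensorProduct.tprod k (Fin.cons b a : Fin (n + 1) → A) ⊗ₜ
        PiTensorProduct.tprod k (Fin.cons b' a' : Fin (n + 1) → A) := by
  simp only [consPair, LinearMap.comp_apply, LinearEquiv.coe_coe, TensorProduct.comm_tmul,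
    TensorProduct.tensorTensorTensorComm_tmul, TensorProduct.map_tmul, consTensor_tmul]

/-- Naturality of the middle exchange. It absorbs the identification of `A` with its first tensor
power, which `legs` applies before regrouping and `snocTensor` after it. -/
lemma map_tensorTensorTensorComm_map {X Y L N E D : Type*} [AddCommMonoid X] [Module k X]
    [AddCommMonoid Y] [Module k Y] [AddCommMonoid L] [Module k L] [AddCommMonoid N] [Module k N]
    [AddCommMonoid E] [Module k E] [AddCommMonoid D] [Module k D] (g : N ⊗[k] L →ₗ[k] E)
    (s : X →ₗ[k] L) (f : D →ₗ[k] N ⊗[k] N) (h : Y →ₗ[k] X ⊗[k] X) :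
    TensorProduct.map g g ∘ₗ (TensorProduct.tensorTensorTensorComm k N N L L).toLinearMap ∘ₗ
        TensorProduct.map f (TensorProduct.map s s ∘ₗ h) =
      TensorProduct.map (g ∘ₗ s.lTensor N) (g ∘ₗ s.lTensor N) ∘ₗ
        (TensorProduct.tensorTensorTensorComm k N N X X).toLinearMap ∘ₗ TensorProduct.map f h := by
  ext d y
  simp only [TensorProduct.AlgebraTensorModule.curry_apply, LinearMap.restrictScalars_self,
    TensorProduct.curry_apply, LinearMap.comp_apply, TensorProduct.map_tmul]
  generalize f d = x
  generalize h y = w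
  induction x with
  | zero => simp
  | add x y hx hy => simp only [TensorProduct.add_tmul, map_add, hx, hy]
  | tmul x x' =>
    induction w with
    | zero => simp
    | add x y hx hy => simp only [TensorProduct.tmul_add, map_add, hx, hy]
    | tmul w w' => simp

lemma snocPair_consPair (n : ℕ) (w w' : A ⊗[k] A) (x : PairPow k A n) :
    snocPair k A (n + 1) (consPair k A n (w ⊗ₜ x) ⊗ₜ w') =
      consPair k A (n + 1) (w ⊗ₜ snocPair k A n (x ⊗ₜ w')) := by
  induction w with
  | zero => simp
  | add w₁ w₂ h₁ h₂ => simp only [TensorProduct.add_tmul, map_add, h₁, h₂]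
  | tmul b b' =>
  induction w' with
  | zero => simp
  | add w₁ w₂ h₁ h₂ => simp only [TensorProduct.tmul_add, map_add, h₁, h₂]
  | tmul d d' =>
  refine LinearMap.congr_fun
    (f := snocPair k A (n + 1) ∘ₗ (TensorProduct.mk k _ _).flip (d ⊗ₜ d') ∘ₗ
      consPair k A n ∘ₗ TensorProduct.mk k _ _ (b ⊗ₜ b'))
    (g := consPair k A (n + 1) ∘ₗ TensorProduct.mk k _ _ (b ⊗ₜ b') ∘ₗ
      snocPair k A n ∘ₗ (TensorProduct.mk k _ _).flip (d ⊗ₜ d')) (PairPow.hom_ext ?_) x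
  intro a a'
  simp only [LinearMap.comp_apply, TensorProduct.mk_apply, LinearMap.flip_apply, snocPair_tmul,
    consPair_tmul, Fin.cons_snoc_eq_snoc_cons]

variable {C : Type*} [AddCommGroup C] [Module k C] [Coalgebra k C]

/-- The map `c ↦ (c₍₁₎^⟨1⟩ ⊗ ⋯ ⊗ c₍ₙ₎^⟨1⟩) ⊗ (c₍₁₎^⟨2⟩ ⊗ ⋯ ⊗ c₍ₙ₎^⟨2⟩)`, with the counit
for `n = 0`. -/
def legsPow (ℓ : C →ₗ[k] A ⊗[k] A) : (n : ℕ) → C →ₗ[k] PairPow k A n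
  | 0 => (Coalgebra.counit (R := k) (A := C)).smulRight
      (PiTensorProduct.tprod k Fin.elim0 ⊗ₜ PiTensorProduct.tprod k Fin.elim0)
  | n + 1 => snocPair k A n ∘ₗ TensorProduct.map (legsPow ℓ n) ℓ ∘ₗ Coalgebra.comul

lemma legsPow_succ (ℓ : C →ₗ[k] A ⊗[k] A) (n : ℕ) :
    legsPow ℓ (n + 1) = snocPair k A n ∘ₗ TensorProduct.map (legsPow ℓ n) ℓ ∘ₗ Coalgebra.comul :=
  rfl

lemma map_smulRight_counit {E F : Type*} [AddCommGroup E] [Module k E] [AddCommGroup F]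
    [Module k F] (u : E) (f : C →ₗ[k] F) :
    TensorProduct.map ((Coalgebra.counit (R := k) (A := C)).smulRight u) f ∘ₗ Coalgebra.comul =
      TensorProduct.mk k E F u ∘ₗ f := by
  have h : TensorProduct.map ((Coalgebra.counit (R := k) (A := C)).smulRight u) f =
      (TensorProduct.mk k E F u ∘ₗ f) ∘ₗ (TensorProduct.lid k C).toLinearMap ∘ₗ
        (Coalgebra.counit (R := k) (A := C)).rTensor C := by
    ext c d
    simp [TensorProduct.smul_tmul]
  rw [h]
  ext c
  simp

lemma map_smulRight_counit' {E F : Type*} [AddCommGroup E] [Module k E] [AddCommGroup F]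
    [Module k F] (u : E) (f : C →ₗ[k] F) :
    TensorProduct.map f ((Coalgebra.counit (R := k) (A := C)).smulRight u) ∘ₗ Coalgebra.comul =
      (TensorProduct.mk k F E).flip u ∘ₗ f := by
  have h : TensorProduct.map f ((Coalgebra.counit (R := k) (A := C)).smulRight u) =
      ((TensorProduct.mk k F E).flip u ∘ₗ f) ∘ₗ (TensorProduct.rid k C).toLinearMap ∘ₗ
        (Coalgebra.counit (R := k) (A := C)).lTensor C := by
    ext c d
    simp
  rw [h]
  ext c
  simp

lemma legsPow_one (ℓ : C →ₗ[k] A ⊗[k] A) (c : C) :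
    legsPow ℓ 1 c = snocPair k A 0
      ((PiTensorProduct.tprod k Fin.elim0 ⊗ₜ PiTensorProduct.tprod k Fin.elim0) ⊗ₜ ℓ c) := by
  rw [legsPow, legsPow, map_smulRight_counit]
  rfl

/-- `legsPow` starts one step earlier, at the counit, which makes its inductions uniform; the index
shifts by one. -/
lemma legs_eq_legsPow (ℓ : C →ₗ[k] A ⊗[k] A) (m : ℕ) : legs ℓ m = legsPow ℓ (m + 1) := by
  have h0 : legs ℓ 0 = legsPow ℓ 1 := by
    ext c
    rw [legsPow_one, legs, LinearMap.comp_apply]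
    induction ℓ c with
    | zero => simp
    | add x y hx hy => simp only [TensorProduct.tmul_add, map_add, hx, hy]
    | tmul a a' =>
      rw [snocPair_tmul, TensorProduct.map_tmul]
      have h (b : A) : (Fin.snoc Fin.elim0 b : Fin 1 → A) = fun _ => b := by
        funext i
        rw [Subsingleton.elim (α := Fin 1) i (Fin.last 0), Fin.snoc_last]
      rw [LinearEquiv.coe_coe, subsingletonEquiv_symm_eq_tprod, subsingletonEquiv_symm_eq_tprod,
        h, h]
  induction m with
  | zero => exact h0
  | succ m ih =>
    rw [legsPow, legs, ih]
    have h := map_tensorTensorTensorComm_map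
      (TensorPower.mulEquiv (R := k) (M := A) (n := m + 1) (m := 1)).toLinearMap
      (PiTensorProduct.subsingletonEquiv (R := k) (s := fun _ : Fin 1 => A) 0).symm.toLinearMap
      (legsPow ℓ (m + 1)) ℓ
    rw [legs, snocPair, snocTensor, LinearMap.comp_assoc]
    refine LinearMap.ext fun c => ?_
    have h' := LinearMap.congr_fun h (Coalgebra.comul c)
    simp only [LinearMap.comp_apply] at h' ⊢
    exact h'

/-- Coassociativity: splitting off the first leg builds the same map as splitting off the last. -/
lemma legsPow_succ' (ℓ : C →ₗ[k] A ⊗[k] A) (n : ℕ) :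
    legsPow ℓ (n + 1) = consPair k A n ∘ₗ TensorProduct.map ℓ (legsPow ℓ n) ∘ₗ Coalgebra.comul := by
  induction n with
  | zero =>
    rw [legsPow_succ, legsPow, map_smulRight_counit, map_smulRight_counit']
    ext c
    simp only [LinearMap.comp_apply, LinearMap.flip_apply, TensorProduct.mk_apply]
    induction ℓ c with
    | zero => simp
    | add x y hx hy => simp only [TensorProduct.tmul_add, TensorProduct.add_tmul, map_add, hx, hy]
    | tmul a a' =>
      rw [snocPair_tmul, consPair_tmul]
      congr 2 <;>
      · funext i
        obtain rfl : i = 0 := Subsingleton.elim (α := Fin 1) i 0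
        rfl
  | succ n ih =>
    rw [legsPow_succ ℓ (n + 1)]
    nth_rw 1 [ih]
    rw [legsPow_succ ℓ n]
    have h1 : TensorProduct.map (consPair k A n ∘ₗ TensorProduct.map ℓ (legsPow ℓ n) ∘ₗ
          Coalgebra.comul) ℓ =
        TensorProduct.map (consPair k A n ∘ₗ TensorProduct.map ℓ (legsPow ℓ n)) ℓ ∘ₗ
          (Coalgebra.comul (R := k) (A := C)).rTensor C := by
      rw [LinearMap.rTensor, ← TensorProduct.map_comp]; rfl
    have h2 : TensorProduct.map ℓ (snocPair k A n ∘ₗ TensorProduct.map (legsPow ℓ n) ℓ ∘ₗ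
          Coalgebra.comul) =
        TensorProduct.map ℓ (snocPair k A n ∘ₗ TensorProduct.map (legsPow ℓ n) ℓ) ∘ₗ
          (Coalgebra.comul (R := k) (A := C)).lTensor C := by
      rw [LinearMap.lTensor, ← TensorProduct.map_comp]; rfl
    rw [h1, h2]
    ext c
    simp only [LinearMap.comp_apply, ← Coalgebra.coassoc_apply]
    generalize (Coalgebra.comul (R := k) (A := C)).rTensor C (Coalgebra.comul c) = z
    refine LinearMap.congr_fun
      (f := snocPair k A (n + 1) ∘ₗ
        TensorProduct.map (consPair k A n ∘ₗ TensorProduct.map ℓ (legsPow ℓ n)) ℓ)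
      (g := consPair k A (n + 1) ∘ₗ
        TensorProduct.map ℓ (snocPair k A n ∘ₗ TensorProduct.map (legsPow ℓ n) ℓ) ∘ₗ
        (TensorProduct.assoc k C C C).toLinearMap) (TensorProduct.ext_threefold ?_) z
    intro x y z
    simp only [LinearMap.comp_apply, LinearEquiv.coe_coe, TensorProduct.assoc_tmul,
      TensorProduct.map_tmul, snocPair_consPair]

/-- Rotation turns a leg appended on the right into one appended on the left, and the cotrace
condition allows the two coproduct factors to be exchanged. -/
lemma rotatePair_legsPow (ℓ : C →ₗ[k] A ⊗[k] A) (n : ℕ) {c : C} (hc : c ∈ cotraces k C) :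
    rotatePair k A n (legsPow ℓ (n + 1) c) = legsPow ℓ (n + 1) c := by
  have hc' : Coalgebra.comul (R := k) c = TensorProduct.comm k C C (Coalgebra.comul c) := hc
  conv_rhs => rw [legsPow_succ']
  rw [legsPow_succ, LinearMap.comp_apply, LinearMap.comp_apply, LinearMap.comp_apply,
    LinearMap.comp_apply]
  -- Only the coproduct on the left-appending side is flipped; the claim then holds for an arbitrary
  -- tensor in place of the coproduct.
  nth_rw 2 [hc']
  induction Coalgebra.comul (R := k) c with
  | zero => simp
  | add x y hx hy => simp only [map_add, hx, hy]
  | tmul c d => simp only [TensorProduct.map_tmul, TensorProduct.comm_tmul, rotatePair_snocPair]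

end Legs

/-! ### The ambient algebra on A ⊗ A and the circular tensor -/

section PairAlg

variable {k : Type*} [Field k]
variable {A : Type*} [Ring A] [Algebra k A]

variable (k A) in
/-- The vector space `A ⊗ A` with the multiplication `(x ⊗ y) (x' ⊗ y') = x y x' ⊗ y'`. -/
def PairAlg : Type _ := A ⊗[k] A

instance : AddCommGroup (PairAlg k A) := inferInstanceAs (AddCommGroup (A ⊗[k] A))

instance : Module k (PairAlg k A) := inferInstanceAs (Module k (A ⊗[k] A))

variable (k A) in
/-- The identification of `A ⊗ A` with the underlying space of `PairAlg k A`. -/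
def toPairAlg : (A ⊗[k] A) ≃ₗ[k] PairAlg k A := LinearEquiv.refl k _

instance : Mul (PairAlg k A) :=
  ⟨fun x y => toPairAlg k A (LinearMap.mul' k A ((toPairAlg k A).symm x) • (toPairAlg k A).symm y)⟩

lemma PairAlg.mul_def (x y : PairAlg k A) : (toPairAlg k A).symm (x * y) =
    LinearMap.mul' k A ((toPairAlg k A).symm x) • (toPairAlg k A).symm y := rfl

instance : NonUnitalRing (PairAlg k A) where
  __ := (inferInstance : AddCommGroup (PairAlg k A))
  mul := (· * ·)
  left_distrib a b c := (toPairAlg k A).symm.injective (by simp [PairAlg.mul_def])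
  right_distrib a b c := (toPairAlg k A).symm.injective (by simp [PairAlg.mul_def, add_smul])
  zero_mul a := (toPairAlg k A).symm.injective (by simp [PairAlg.mul_def])
  mul_zero a := (toPairAlg k A).symm.injective (by simp [PairAlg.mul_def])
  mul_assoc a b c := (toPairAlg k A).symm.injective (by
    simp [PairAlg.mul_def, mul'_smul, mul_smul])

instance : IsScalarTower k (PairAlg k A) (PairAlg k A) :=
  ⟨fun r a b => (toPairAlg k A).symm.injective (by
    rw [smul_eq_mul, smul_eq_mul, PairAlg.mul_def, map_smul, map_smul, map_smul, PairAlg.mul_def,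
      smul_assoc])⟩

instance : SMulCommClass k (PairAlg k A) (PairAlg k A) :=
  ⟨fun r a b => (toPairAlg k A).symm.injective (by
    rw [smul_eq_mul, smul_eq_mul, map_smul, PairAlg.mul_def, PairAlg.mul_def, map_smul,
      smul_comm])⟩

variable (k A) in
/-- The map `a ⊗ a' ↦ a' ⊗ a`, as a bilinear map to `PairAlg k A`. -/
def pairMk : A →ₗ[k] A →ₗ[k] PairAlg k A :=
  (TensorProduct.mk k A A).flip.compr₂ (toPairAlg k A).toLinearMap

lemma pairMk_apply (a a' : A) : pairMk k A a a' = toPairAlg k A (a' ⊗ₜ a) := rfl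

lemma pairMk_mul_pairMk (a a' b b' : A) :
    pairMk k A a a' * pairMk k A b b' = pairMk k A b (a' * (a * b')) := by
  apply (toPairAlg k A).symm.injective
  simp [PairAlg.mul_def, pairMk_apply, TensorProduct.smul_tmul', mul_assoc]

variable (k A) in
/-- The map `(a₀ ⊗ ⋯ ⊗ aₙ) ⊗ (a'₀ ⊗ ⋯ ⊗ a'ₙ) ↦ (a'ₙ ⊗ a₀) ⊗ (a'₀ ⊗ a₁) ⊗ ⋯ ⊗ (a'ₙ₋₁ ⊗ aₙ)`. -/
def interleave (n : ℕ) : PairPow k A (n + 1) →ₗ[k] ⨂[k]^(n + 1) (PairAlg k A) :=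
  TensorProduct.lift (PiTensorProduct.map₂ fun _ => pairMk k A) ∘ₗ (rotate k A n).lTensor _

lemma interleave_tmul {n : ℕ} (a a' : Fin (n + 1) → A) :
    interleave k A n (PiTensorProduct.tprod k a ⊗ₜ PiTensorProduct.tprod k a') =
      PiTensorProduct.tprod k fun i => pairMk k A (a i) (a' ((finRotate (n + 1)).symm i)) := by
  rw [interleave, LinearMap.comp_apply, LinearMap.lTensor_tmul, rotate_tprod,
    TensorProduct.lift.tmul]
  exact PiTensorProduct.map₂_tprod_tprod _ _ _

lemma rotate_interleave (n : ℕ) (x : PairPow k A (n + 1)) :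
    rotate k (PairAlg k A) n (interleave k A n x) = interleave k A n (rotatePair k A n x) := by
  refine LinearMap.congr_fun (f := rotate k _ n ∘ₗ interleave k A n)
    (g := interleave k A n ∘ₗ rotatePair k A n) (PairPow.hom_ext fun a a' => ?_) x
  simp only [LinearMap.comp_apply, interleave_tmul, rotate_tprod, rotatePair,
    TensorProduct.map_tmul]

/-- The dependence on `b'` is isolated in slot 0, so that a coaction on `b'` can be expanded by
multilinearity. The `0` in `Fin.cons 0 a'` is a placeholder that the update overwrites; the same
device serves `b` in `interleave_consPair`. -/
lemma interleave_snocPair {n : ℕ} (a a' : Fin n → A) (b b' : A) :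
    interleave k A n (snocPair k A n
      ((PiTensorProduct.tprod k a ⊗ₜ PiTensorProduct.tprod k a') ⊗ₜ (b ⊗ₜ b'))) =
    PiTensorProduct.tprod k (Function.update
      (fun i => pairMk k A ((Fin.snoc a b : Fin (n + 1) → A) i) ((Fin.cons 0 a' : Fin (n + 1) → A) i))
      0 (pairMk k A ((Fin.snoc a b : Fin (n + 1) → A) 0) b')) := by
  rw [snocPair_tmul, interleave_tmul]
  congr 1
  funext i
  rw [congrFun (snoc_comp_finRotate_symm a' b') i]
  refine Fin.cases ?_ (fun i => ?_) i
  · simp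
  · simp

lemma interleave_consPair {n : ℕ} (a a' : Fin n → A) (b b' : A) :
    interleave k A n (consPair k A n
      ((b ⊗ₜ b') ⊗ₜ (PiTensorProduct.tprod k a ⊗ₜ PiTensorProduct.tprod k a'))) =
    PiTensorProduct.tprod k (Function.update
      (fun i => pairMk k A ((Fin.cons 0 a : Fin (n + 1) → A) i)
        ((Fin.cons b' a' : Fin (n + 1) → A) ((finRotate (n + 1)).symm i)))
      0 (pairMk k A b ((Fin.cons b' a' : Fin (n + 1) → A) ((finRotate (n + 1)).symm 0)))) := by
  rw [consPair_tmul, interleave_tmul]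
  congr 1
  funext i
  refine Fin.cases ?_ (fun i => ?_) i
  · simp
  · simp

variable (k A) in
/-- Right multiplication on the last entry of the second tensor. -/
def mulLast (n : ℕ) : A →ₗ[k] PairPow k A (n + 1) →ₗ[k] PairPow k A (n + 1) :=
  LinearMap.lTensorHom _ ∘ₗ
    (PiTensorProduct.mapMultilinear k (fun _ : Fin (n + 1) => A) (fun _ => A)).toLinearMap
      (fun _ => LinearMap.id) (Fin.last n) ∘ₗ (LinearMap.mul k A).flip

lemma mulLast_tmul (n : ℕ) (y : A) (a a' : Fin (n + 1) → A) :
    mulLast k A n y (PiTensorProduct.tprod k a ⊗ₜ PiTensorProduct.tprod k a') =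
      PiTensorProduct.tprod k a ⊗ₜ PiTensorProduct.tprod k
        (Function.update a' (Fin.last n) (a' (Fin.last n) * y)) := by
  change PiTensorProduct.tprod k a ⊗ₜ PiTensorProduct.map (Function.update (fun _ => LinearMap.id)
    (Fin.last n) ((LinearMap.mul k A).flip y)) (PiTensorProduct.tprod k a') = _
  rw [PiTensorProduct.map_tprod]
  congr 2
  funext i
  by_cases h : i = Fin.last n
  · subst h; simp
  · simp [h]

lemma mulLast_one (n : ℕ) : mulLast k A n 1 = LinearMap.id :=
  PairPow.hom_ext fun a a' => by simp [mulLast_tmul]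

/-- The factors b and b' of the last pair lie in the last slot and in slot 0, which the last face
multiplies. -/
lemma lastFace_interleave_snocPair (n : ℕ) (x : PairPow k A (n + 1)) (w : A ⊗[k] A) :
    lastFace k (PairAlg k A) n (interleave k A (n + 1) (snocPair k A (n + 1) (x ⊗ₜ w))) =
      interleave k A n (mulLast k A n (LinearMap.mul' k A w) x) := by
  induction w with
  | zero => simp
  | add w₁ w₂ h₁ h₂ => simp only [TensorProduct.tmul_add, map_add, h₁, h₂, LinearMap.add_apply]
  | tmul b b' =>
  refine LinearMap.congr_fun (f := lastFace k (PairAlg k A) n ∘ₗ interleave k A (n + 1) ∘ₗ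
      snocPair k A (n + 1) ∘ₗ (TensorProduct.mk k _ _).flip (b ⊗ₜ b'))
    (g := interleave k A n ∘ₗ mulLast k A n (LinearMap.mul' k A (b ⊗ₜ b')))
    (PairPow.hom_ext fun a a' => ?_) x
  simp only [LinearMap.comp_apply, LinearMap.flip_apply, TensorProduct.mk_apply, mulLast_tmul,
    snocPair_tmul, interleave_tmul, LinearMap.mul'_apply, lastFace, rotate_tprod, face_tprod]
  congr 1
  have h0 (m : ℕ) : (finRotate (m + 1)).symm 0 = Fin.last m := by
    rw [Equiv.symm_apply_eq, finRotate_last]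
  have hs (m : ℕ) (i : Fin m) : (finRotate (m + 1)).symm i.succ = i.castSucc := by
    rw [Equiv.symm_apply_eq, finRotate_apply, Fin.coeSucc_eq_succ]
  funext i
  refine Fin.cases ?_ (fun i => ?_) i
  -- The slot where the work happens: (a'_n ⊗ b)(b' ⊗ a_0) = a'_n b b' ⊗ a_0.
  · rw [Fin.contractNth_apply_of_eq _ _ _ _ (by simp)]
    simp only [Fin.castSucc_zero, h0, hs, Fin.snoc_last, Function.update_self]
    have ha : (Fin.snoc a b : Fin (n + 2) → A) 0 = a 0 :=
      Fin.snoc_castSucc (α := fun _ => A) b a 0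
    rw [← Fin.succ_last, hs, Fin.snoc_castSucc, ha, pairMk_mul_pairMk]
  · rw [Fin.contractNth_apply_of_gt _ _ _ _ (by simp)]
    simp only [hs, Fin.snoc_castSucc]
    rw [Fin.castSucc_succ, hs, Fin.snoc_castSucc, Function.update_of_ne (Fin.castSucc_lt_last i).ne]

variable {C : Type*} [AddCommGroup C] [Module k C] [Coalgebra k C]

lemma circular_eq_interleave (ℓ : C →ₗ[k] A ⊗[k] A) (m : ℕ) (c : C) :
    circular ℓ m c = interleave k A m (legsPow ℓ (m + 1) c) := by
  rw [← legs_eq_legsPow]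
  rfl

lemma rotate_interleave_legsPow (ℓ : C →ₗ[k] A ⊗[k] A) (n : ℕ) {c : C} (hc : c ∈ cotraces k C) :
    rotate k (PairAlg k A) n (interleave k A n (legsPow ℓ (n + 1) c)) =
      interleave k A n (legsPow ℓ (n + 1) c) := by
  rw [rotate_interleave, rotatePair_legsPow ℓ n hc]

/-- The last leg collapses to its counit, which the counit axiom then removes. No cotrace condition
is needed here. -/
lemma lastFace_interleave_legsPow {ℓ : C →ₗ[k] A ⊗[k] A}
    (hℓ : ∀ c, LinearMap.mul' k A (ℓ c) = Coalgebra.counit (R := k) c • 1) (n : ℕ) (c : C) :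
    lastFace k (PairAlg k A) n (interleave k A (n + 1) (legsPow ℓ (n + 2) c)) =
      interleave k A n (legsPow ℓ (n + 1) c) := by
  have h (z : C ⊗[k] C) : lastFace k (PairAlg k A) n (interleave k A (n + 1)
      (snocPair k A (n + 1) (TensorProduct.map (legsPow ℓ (n + 1)) ℓ z))) =
      interleave k A n (legsPow ℓ (n + 1) (TensorProduct.rid k C
        ((Coalgebra.counit (R := k) (A := C)).lTensor C z))) := by
    induction z with
    | zero => simp
    | add z w hz hw => simp only [map_add, hz, hw]
    | tmul c d =>
      rw [TensorProduct.map_tmul, lastFace_interleave_snocPair, hℓ, map_smul, mulLast_one]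
      simp
  rw [legsPow_succ ℓ (n + 1), LinearMap.comp_apply, LinearMap.comp_apply, h]
  simp

end PairAlg

/-! ### Descent of the circular tensor to the cotensor product -/

section Cotensor

variable {k : Type*} [Field k]

/-- A generalized inverse: split `f` over its range and extend the splitting to all of `U`. Then id
- s f is a projection onto the kernel of `f`, which is how M is split off below. -/
lemma exists_comp_comp_eq {V U : Type*} [AddCommGroup V] [Module k V] [AddCommGroup U] [Module k U]
    (f : V →ₗ[k] U) : ∃ s : U →ₗ[k] V, f ∘ₗ s ∘ₗ f = f := by
  obtain ⟨r, hr⟩ := f.rangeRestrict.exists_rightInverse_of_surjective f.range_rangeRestrict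
  obtain ⟨s, hs⟩ := r.exists_extend
  refine ⟨s, LinearMap.ext fun x => ?_⟩
  have h1 : s (f x) = r (f.rangeRestrict x) := LinearMap.congr_fun hs (f.rangeRestrict x)
  rw [LinearMap.comp_apply, LinearMap.comp_apply, h1]
  exact congrArg Subtype.val (LinearMap.congr_fun hr (f.rangeRestrict x))

variable {C : Type*} [AddCommGroup C] [Module k C] [Coalgebra k C]
variable {A : Type*} [Ring A] [Algebra k A]

/-- For `s : A ⊗ (C ⊗ A) → A ⊗ A` and `d ∈ C`, the map `a ⊗ a' ↦ s(a ⊗ d ⊗ a')`. -/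
def insertMiddle (s : A ⊗[k] (C ⊗[k] A) →ₗ[k] PairAlg k A) :
    C →ₗ[k] PairAlg k A →ₗ[k] PairAlg k A :=
  LinearMap.lcomp k _ (toPairAlg k A).symm.toLinearMap ∘ₗ LinearMap.compRight k s ∘ₗ
    LinearMap.lTensorHom A ∘ₗ TensorProduct.mk k C A

lemma insertMiddle_tmul (s : A ⊗[k] (C ⊗[k] A) →ₗ[k] PairAlg k A) (d : C) (a a' : A) :
    insertMiddle s d (toPairAlg k A (a ⊗ₜ a')) = s (a ⊗ₜ (d ⊗ₜ a')) := rfl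

/-- The map `x ⊗ d ↦ (s(a'ₙ ⊗ d ⊗ a₀)) ⊗ (a'₀ ⊗ a₁) ⊗ ⋯ ⊗ (a'ₙ₋₁ ⊗ aₙ)`, where
`x = (a₀ ⊗ ⋯ ⊗ aₙ) ⊗ (a'₀ ⊗ ⋯ ⊗ a'ₙ)`. -/
def interleaveWith (s : A ⊗[k] (C ⊗[k] A) →ₗ[k] PairAlg k A) (n : ℕ) :
    PairPow k A (n + 1) ⊗[k] C →ₗ[k] ⨂[k]^(n + 1) (PairAlg k A) :=
  TensorProduct.lift ((mapZero n ∘ₗ insertMiddle s).flip ∘ₗ interleave k A n)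

lemma interleaveWith_tmul (s : A ⊗[k] (C ⊗[k] A) →ₗ[k] PairAlg k A) (n : ℕ)
    (x : PairPow k A (n + 1)) (d : C) :
    interleaveWith s n (x ⊗ₜ d) = mapZero n (insertMiddle s d) (interleave k A n x) := rfl

/-- The left factor of slot 0 is the second factor of the last pair, so the right coaction in slot 0
can be performed on `w` before the pair is appended. -/
lemma mapZero_interleave_snocPair (s : A ⊗[k] (C ⊗[k] A) →ₗ[k] PairAlg k A)
    (ρ : A →ₗ[k] A ⊗[k] C) (n : ℕ) (x : PairPow k A n) (w : A ⊗[k] A) :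
    mapZero n (s ∘ₗ ((TensorProduct.assoc k A C A).toLinearMap ∘ₗ ρ.rTensor A) ∘ₗ
        (toPairAlg k A).symm.toLinearMap) (interleave k A n (snocPair k A n (x ⊗ₜ w))) =
      interleaveWith s n ((snocPair k A n).rTensor C ((TensorProduct.assoc k _ _ C).symm
        (x ⊗ₜ (TensorProduct.assoc k A A C).symm (ρ.lTensor A w)))) := by
  induction w with
  | zero => simp
  | add w₁ w₂ h₁ h₂ => simp only [TensorProduct.tmul_add, map_add, h₁, h₂]
  | tmul b b' =>
  refine LinearMap.congr_fun (f := mapZero n (s ∘ₗ ((TensorProduct.assoc k A C A).toLinearMap ∘ₗ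
      ρ.rTensor A) ∘ₗ (toPairAlg k A).symm.toLinearMap) ∘ₗ interleave k A n ∘ₗ snocPair k A n ∘ₗ
      (TensorProduct.mk k _ _).flip (b ⊗ₜ b'))
    (g := interleaveWith s n ∘ₗ (snocPair k A n).rTensor C ∘ₗ
      (TensorProduct.assoc k _ _ C).symm.toLinearMap ∘ₗ (TensorProduct.mk k _ _).flip
        ((TensorProduct.assoc k A A C).symm (ρ.lTensor A (b ⊗ₜ b'))))
    (PairPow.hom_ext fun a a' => ?_) x
  simp only [LinearMap.comp_apply, LinearMap.flip_apply, TensorProduct.mk_apply,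
    interleave_snocPair, mapZero_tprod, LinearMap.lTensor_tmul, LinearEquiv.coe_coe, pairMk_apply,
    LinearEquiv.symm_apply_apply, LinearMap.rTensor_tmul]
  induction ρ b' with
  | zero => simp
  | add z₁ z₂ h₁ h₂ =>
    simp only [TensorProduct.add_tmul, TensorProduct.tmul_add, map_add,
      MultilinearMap.map_update_add, h₁, h₂]
  | tmul d d' =>
    simp only [TensorProduct.assoc_tmul, TensorProduct.assoc_symm_tmul, LinearMap.rTensor_tmul,
      interleaveWith_tmul, interleave_snocPair, mapZero_tprod, insertMiddle_tmul, pairMk_apply]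

lemma mapZero_interleave_consPair (s : A ⊗[k] (C ⊗[k] A) →ₗ[k] PairAlg k A)
    (ν : A →ₗ[k] C ⊗[k] A) (n : ℕ) (x : PairPow k A n) (w : A ⊗[k] A) :
    mapZero n (s ∘ₗ ν.lTensor A ∘ₗ (toPairAlg k A).symm.toLinearMap)
        (interleave k A n (consPair k A n (w ⊗ₜ x))) =
      interleaveWith s n (TensorProduct.comm k C _ ((consPair k A n).lTensor C
        (TensorProduct.assoc k C _ _ (TensorProduct.assoc k C A A (ν.rTensor A w) ⊗ₜ x)))) := by
  induction w with
  | zero => simp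
  | add w₁ w₂ h₁ h₂ => simp only [TensorProduct.add_tmul, map_add, h₁, h₂]
  | tmul b b' =>
  refine LinearMap.congr_fun (f := mapZero n (s ∘ₗ ν.lTensor A ∘ₗ
      (toPairAlg k A).symm.toLinearMap) ∘ₗ interleave k A n ∘ₗ consPair k A n ∘ₗ
      TensorProduct.mk k _ _ (b ⊗ₜ b'))
    (g := interleaveWith s n ∘ₗ (TensorProduct.comm k C _).toLinearMap ∘ₗ
      (consPair k A n).lTensor C ∘ₗ (TensorProduct.assoc k C _ _).toLinearMap ∘ₗ
      TensorProduct.mk k _ _ (TensorProduct.assoc k C A A (ν.rTensor A (b ⊗ₜ b'))))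
    (PairPow.hom_ext fun a a' => ?_) x
  simp only [LinearMap.comp_apply, TensorProduct.mk_apply,
    interleave_consPair, mapZero_tprod, LinearMap.lTensor_tmul, LinearEquiv.coe_coe, pairMk_apply,
    LinearEquiv.symm_apply_apply, LinearMap.rTensor_tmul]
  induction ν b with
  | zero => simp
  | add z₁ z₂ h₁ h₂ =>
    simp only [TensorProduct.add_tmul, TensorProduct.tmul_add, map_add,
      MultilinearMap.map_update_add, h₁, h₂]
  | tmul d d' =>
    simp only [TensorProduct.assoc_tmul, LinearMap.lTensor_tmul, TensorProduct.comm_tmul,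
      interleaveWith_tmul, interleave_consPair, mapZero_tprod, insertMiddle_tmul, pairMk_apply]

/-- By right colinearity, coacting on the last leg only splits it once more; coassociativity
collects the new factor as the last leg of all. -/
lemma mapZero_interleave_legsPow_right {ℓ : C →ₗ[k] A ⊗[k] A} {ρ : A →ₗ[k] A ⊗[k] C}
    (hρ : ρ.lTensor A ∘ₗ ℓ =
      (TensorProduct.assoc k A A C).toLinearMap ∘ₗ ℓ.rTensor C ∘ₗ Coalgebra.comul)
    (s : A ⊗[k] (C ⊗[k] A) →ₗ[k] PairAlg k A) (n : ℕ) (c : C) :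
    mapZero n (s ∘ₗ ((TensorProduct.assoc k A C A).toLinearMap ∘ₗ ρ.rTensor A) ∘ₗ
        (toPairAlg k A).symm.toLinearMap) (interleave k A n (legsPow ℓ (n + 1) c)) =
      interleaveWith s n ((legsPow ℓ (n + 1)).rTensor C (Coalgebra.comul c)) := by
  have h (z : C ⊗[k] C) : mapZero n (s ∘ₗ ((TensorProduct.assoc k A C A).toLinearMap ∘ₗ
        ρ.rTensor A) ∘ₗ (toPairAlg k A).symm.toLinearMap) (interleave k A n
        (snocPair k A n (TensorProduct.map (legsPow ℓ n) ℓ z))) =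
      interleaveWith s n ((snocPair k A n ∘ₗ TensorProduct.map (legsPow ℓ n) ℓ).rTensor C
        ((TensorProduct.assoc k C C C).symm
          ((Coalgebra.comul (R := k) (A := C)).lTensor C z))) := by
    induction z with
    | zero => simp
    | add z w hz hw => simp only [map_add, hz, hw]
    | tmul c d =>
      have hd : ρ.lTensor A (ℓ d) =
          TensorProduct.assoc k A A C (ℓ.rTensor C (Coalgebra.comul d)) :=
        LinearMap.congr_fun hρ d
      rw [TensorProduct.map_tmul, mapZero_interleave_snocPair, hd, LinearEquiv.symm_apply_apply,
        LinearMap.lTensor_tmul]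
      induction Coalgebra.comul (R := k) d with
      | zero => simp
      | add z w hz hw => simp only [TensorProduct.tmul_add, map_add, hz, hw]
      | tmul d d' => simp
  have h2 : (legsPow ℓ (n + 1)).rTensor C (Coalgebra.comul c) =
      (snocPair k A n ∘ₗ TensorProduct.map (legsPow ℓ n) ℓ).rTensor C
        ((Coalgebra.comul (R := k) (A := C)).rTensor C (Coalgebra.comul c)) := by
    rw [← LinearMap.rTensor_comp_apply, LinearMap.comp_assoc, legsPow_succ]
  rw [h2, legsPow_succ, LinearMap.comp_apply, LinearMap.comp_apply, h, Coalgebra.coassoc_symm_apply]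

/-- The mirror image: left colinearity splits the first leg, and the inserted element is the first
Sweedler factor. -/
lemma mapZero_interleave_legsPow_left {ℓ : C →ₗ[k] A ⊗[k] A} {ν : A →ₗ[k] C ⊗[k] A}
    (hν : (TensorProduct.assoc k C A A).toLinearMap ∘ₗ ν.rTensor A ∘ₗ ℓ =
      ℓ.lTensor C ∘ₗ Coalgebra.comul)
    (s : A ⊗[k] (C ⊗[k] A) →ₗ[k] PairAlg k A) (n : ℕ) (c : C) :
    mapZero n (s ∘ₗ ν.lTensor A ∘ₗ (toPairAlg k A).symm.toLinearMap)
        (interleave k A n (legsPow ℓ (n + 1) c)) =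
      interleaveWith s n (TensorProduct.comm k C _
        ((legsPow ℓ (n + 1)).lTensor C (Coalgebra.comul c))) := by
  have h (z : C ⊗[k] C) : mapZero n (s ∘ₗ ν.lTensor A ∘ₗ (toPairAlg k A).symm.toLinearMap)
        (interleave k A n (consPair k A n (TensorProduct.map ℓ (legsPow ℓ n) z))) =
      interleaveWith s n (TensorProduct.comm k C _
        ((consPair k A n ∘ₗ TensorProduct.map ℓ (legsPow ℓ n)).lTensor C
          (TensorProduct.assoc k C C C
            ((Coalgebra.comul (R := k) (A := C)).rTensor C z)))) := by
    induction z with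
    | zero => simp
    | add z w hz hw => simp only [map_add, hz, hw]
    | tmul c d =>
      have hc : TensorProduct.assoc k C A A (ν.rTensor A (ℓ c)) =
          ℓ.lTensor C (Coalgebra.comul c) := LinearMap.congr_fun hν c
      rw [TensorProduct.map_tmul, mapZero_interleave_consPair, hc, LinearMap.rTensor_tmul]
      induction Coalgebra.comul (R := k) c with
      | zero => simp
      | add z w hz hw => simp only [TensorProduct.add_tmul, map_add, hz, hw]
      | tmul d d' => simp
  have h2 : (legsPow ℓ (n + 1)).lTensor C (Coalgebra.comul c) =
      (consPair k A n ∘ₗ TensorProduct.map ℓ (legsPow ℓ n)).lTensor C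
        ((Coalgebra.comul (R := k) (A := C)).lTensor C (Coalgebra.comul c)) := by
    rw [← LinearMap.lTensor_comp_apply, LinearMap.comp_assoc, legsPow_succ']
  rw [h2]
  conv_lhs => rw [legsPow_succ']
  rw [LinearMap.comp_apply, LinearMap.comp_apply, h, Coalgebra.coassoc_apply]

namespace GaloisExtension

variable (G : GaloisExtension k C A)

/-- The inclusion `M → A ⊗ A`, as an algebra map. -/
def inclAlg : G.M →ₙₐ[k] PairAlg k A where
  toFun m := toPairAlg k A (G.incl m)
  map_smul' r m := by simp
  map_zero' := by simp
  map_add' m m' := by simp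
  map_mul' m m' := rfl

variable {G} {ℓ : C →ₗ[k] A ⊗[k] A}

namespace IsStrongConnection

/-- Applying the counit to can(x ⊗ y) = x y_(0) ⊗ y_(1) gives x y, while ℓ(c) is sent by the lifted
canonical map to 1 ⊗ c. -/
lemma mul'_apply (hℓ : G.IsStrongConnection ℓ) (c : C) :
    LinearMap.mul' k A (ℓ c) = Coalgebra.counit (R := k) c • 1 := by
  have h1 : canLift G.coact (ℓ c) = 1 ⊗ₜ c := by
    rw [← can_mk, ← can_translation G.coact G.can_bijective, ← hℓ.lifts]
    rfl
  have h2 (z : A ⊗[k] A) : TensorProduct.rid k A ((Coalgebra.counit (R := k) (A := C)).lTensor A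
      (canLift G.coact z)) = LinearMap.mul' k A z := by
    induction z with
    | zero => simp
    | add z w hz hw => simp only [map_add, hz, hw]
    | tmul a b =>
      have h3 : TensorProduct.rid k A ((Coalgebra.counit (R := k) (A := C)).lTensor A
        (G.coact b)) = b := LinearMap.congr_fun G.coact_counit b
      rw [canLift_tmul, LinearMap.mul'_apply]
      nth_rw 2 [← h3]
      induction G.coact b with
      | zero => simp
      | add z w hz hw => simp only [smul_add, map_add, hz, hw, mul_add]
      | tmul x y => simp [TensorProduct.smul_tmul']
  rw [← h2, h1]
  simp

lemma exists_inclPow_eq (hℓ : G.IsStrongConnection ℓ) (m : ℕ) {c : C} (hc : c ∈ cotraces k C) :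
    ∃ x, G.inclPow m x = circular ℓ m c := by
  set α : A ⊗[k] A →ₗ[k] A ⊗[k] (C ⊗[k] A) :=
    (TensorProduct.assoc k A C A).toLinearMap ∘ₗ G.coact.rTensor A with hα
  set β : A ⊗[k] A →ₗ[k] A ⊗[k] (C ⊗[k] A) := G.leftCoact.lTensor A with hβ
  obtain ⟨s, hs⟩ := exists_comp_comp_eq (α - β)
  -- A projection onto M, the kernel of α - β.
  set p : A ⊗[k] A →ₗ[k] A ⊗[k] A := LinearMap.id - s ∘ₗ (α - β) with hp
  have hpM (x : A ⊗[k] A) : p x ∈ G.cotensor := by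
    have h' : (α - β) (p x) = 0 := by
      rw [hp, LinearMap.sub_apply LinearMap.id, map_sub]
      exact sub_eq_zero.2 (LinearMap.congr_fun hs x).symm
    exact sub_eq_zero.1 h'
  set y := interleave k A m (legsPow ℓ (m + 1) c) with hy
  set s' := (toPairAlg k A).toLinearMap ∘ₗ s
  -- The same projection on `PairAlg k A`, with the two coactions kept in separate summands to match
  -- the two colinearity lemmas.
  set q : PairAlg k A →ₗ[k] PairAlg k A :=
    LinearMap.id - (s' ∘ₗ α ∘ₗ (toPairAlg k A).symm.toLinearMap -
      s' ∘ₗ β ∘ₗ (toPairAlg k A).symm.toLinearMap) with hq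
  have hc' : TensorProduct.comm k C C (Coalgebra.comul c) = Coalgebra.comul (R := k) c :=
    (show Coalgebra.comul (R := k) c = _ from hc).symm
  -- The cotrace condition identifies the extra first leg with the extra last leg.
  have h1 : TensorProduct.comm k C _ ((legsPow ℓ (m + 1)).lTensor C (Coalgebra.comul c)) =
      (legsPow ℓ (m + 1)).rTensor C (Coalgebra.comul c) := by
    nth_rw 2 [← hc']
    induction Coalgebra.comul (R := k) c with
    | zero => simp
    | add z w hz hw => simp only [map_add, hz, hw]
    | tmul c d => simp
  have h2 : mapZero m q y = y := by
    rw [hq, map_sub, map_sub, LinearMap.sub_apply, LinearMap.sub_apply, hy, hα, hβ,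
      mapZero_interleave_legsPow_right hℓ.right_colinear,
      mapZero_interleave_legsPow_left hℓ.left_colinear, h1, sub_self, sub_zero, mapZero_eq,
      Function.update_eq_self_iff.2 rfl, PiTensorProduct.map_id, LinearMap.id_apply]
  have h3 := map_eq_of_mapZero_eq (rotate_interleave_legsPow ℓ m hc) q h2
  set r : PairAlg k A →ₗ[k] G.M := p.codRestrict G.cotensor hpM
  have h4 : q = (G.inclAlg : G.M →ₗ[k] PairAlg k A) ∘ₗ r := by
    refine LinearMap.ext fun x => ?_
    exact congrArg (x - ·) (map_sub s (α x) (β x)).symm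
  refine ⟨PiTensorProduct.map (fun _ => r) y, ?_⟩
  rw [circular_eq_interleave]
  rw [h4, PiTensorProduct.map_comp] at h3
  exact h3

/-- The map `c_m(ℓ)` from the cotraces to the tensor powers of `M`. -/
def chernTensor (hℓ : G.IsStrongConnection ℓ) (m : ℕ) : cotraces k C →ₗ[k] ⨂[k]^(m + 1) G.M :=
  (LinearEquiv.ofInjective (G.inclPow m) (G.inclPow_injective m)).symm.toLinearMap ∘ₗ
    (circular ℓ m ∘ₗ (cotraces k C).subtype).codRestrict (LinearMap.range (G.inclPow m))
      fun c => hℓ.exists_inclPow_eq m c.2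

lemma inclPow_chernTensor (hℓ : G.IsStrongConnection ℓ) (m : ℕ) (c : cotraces k C) :
    G.inclPow m (hℓ.chernTensor m c) = circular ℓ m c :=
  congrArg Subtype.val ((LinearEquiv.ofInjective (G.inclPow m)
    (G.inclPow_injective m)).apply_symm_apply _)

/-- M^{⊗(m+1)} embeds by an algebra map, so faces and rotations can be compared in the tensor powers
of `PairAlg k A`. -/
lemma isCyclicSequence_chernTensor (hℓ : G.IsStrongConnection ℓ) (c : cotraces k C) :
    IsCyclicSequence (k := k) fun m => hℓ.chernTensor m c := by
  have h (m : ℕ) : PiTensorProduct.map (fun _ => (G.inclAlg : G.M →ₗ[k] PairAlg k A))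
      (hℓ.chernTensor m c) = interleave k A m (legsPow ℓ (m + 1) c) := by
    rw [← circular_eq_interleave]
    exact hℓ.inclPow_chernTensor m c
  have hinj (m : ℕ) : Function.Injective (PiTensorProduct.map (ι := Fin (m + 1))
      (fun _ => (G.inclAlg : G.M →ₗ[k] PairAlg k A))) := G.inclPow_injective m
  refine ⟨fun m => hinj m ?_, fun m => hinj m ?_⟩
  · rw [← map_rotate, h, rotate_interleave_legsPow ℓ m c.2]
  · rw [lastFace, LinearMap.comp_apply, ← map_face, ← map_rotate, h, h]
    exact lastFace_interleave_legsPow hℓ.mul'_apply m c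

end IsStrongConnection

end GaloisExtension

end Cotensor

/-! ### Linearity of the chain and the Chern–Weil map -/

lemma chernChain_add {k R : Type*} [Field k] [NonUnitalRing R] [Module k R]
    (x y : (m : ℕ) → ⨂[k]^(m + 1) R) (n : ℕ) :
    chernChain (fun m => x m + y m) n = chernChain x n + chernChain y n :=
  funext fun _ => smul_add _ _ _

lemma chernChain_smul {k R : Type*} [Field k] [NonUnitalRing R] [Module k R] (r : k)
    (x : (m : ℕ) → ⨂[k]^(m + 1) R) (n : ℕ) :
    chernChain (fun m => r • x m) n = r • chernChain x n :=
  funext fun _ => smul_comm _ _ _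

end ChernWeil

end

theorem mainTheorem1 {k : Type*} [Field k] {C : Type*} [AddCommGroup C] [Module k C]
    [Coalgebra k C] {A : Type*} [Ring A] [Algebra k A]
    (G : ChernWeil.GaloisExtension k C A)
    (ℓ : C →ₗ[k] A ⊗[k] A) (hℓ : G.IsStrongConnection ℓ) :
    ∃ c : ∀ m : ℕ, ChernWeil.cotraces k C →ₗ[k] ⨂[k]^(m + 1) G.M,
      (∀ (m : ℕ) (x : ChernWeil.cotraces k C),
        G.inclPow m (c m x) = ChernWeil.circular ℓ m x) ∧
      ∃ hcyc : ∀ (n : ℕ) (x : ChernWeil.cotraces k C),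
          ChernWeil.chernChain (fun m => c m x) n ∈ ChernWeil.cycles k G.M (2 * n),
        (∀ (n : ℕ) (x : ChernWeil.cotraces k C),
          ChernWeil.HC.S k G.M (2 * n) (ChernWeil.HC.mk (hcyc (n + 1) x)) =
            ChernWeil.HC.mk (hcyc n x)) ∧
        ∃ chw : ∀ n : ℕ, ChernWeil.cotraces k C →ₗ[k] ChernWeil.HC k G.B (2 * n),
          ∀ (n : ℕ) (x : ChernWeil.cotraces k C),
            chw n x = ChernWeil.HC.map G.augmentation (2 * n) (ChernWeil.HC.mk (hcyc n x)) := by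
  have hcyc (n : ℕ) (x : ChernWeil.cotraces k C) :
      ChernWeil.chernChain (fun m => hℓ.chernTensor m x) n ∈ ChernWeil.cycles k G.M (2 * n) :=
    (hℓ.isCyclicSequence_chernTensor x).chernChain_mem_cycles n
  -- Stability under S is `rfl`: the coefficients do not involve `n`, and dropping columns 0 and 1
  -- removes exactly the terms m = 2n + 1 and m = 2n + 2.
  refine ⟨hℓ.chernTensor, hℓ.inclPow_chernTensor, hcyc, fun n x => rfl, fun n =>
    ChernWeil.HC.map G.augmentation (2 * n) ∘ₗ Submodule.mkQ _ ∘ₗ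
      { toFun := fun x => ⟨ChernWeil.chernChain (fun m => hℓ.chernTensor m x) n, hcyc n x⟩
        map_add' := fun x y => Subtype.ext ?_
        map_smul' := fun r x => Subtype.ext ?_ }, fun n x => rfl⟩
  · simp only [map_add, ChernWeil.chernChain_add]
    rfl
  · simp only [map_smul, ChernWeil.chernChain_smul]
    rfl
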